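/- Let $n=2d\ge 4$ be an even integer. For a finite field $\mathbb F_q$ with $q$ elements, $q$ odd, of characteristic $p$, let $\chi(c)=e^{2\pi i\,\mathrm{Tr}(c)/p}$ be its canonical additive character ($\mathrm{Tr}$ is the trace to $\mathbb F_p$) and let $$\mathcal F=\{(\alpha,\ \alpha\cdot\alpha,\ \beta,\ \alpha\cdot\beta):\ \alpha,\beta\in\mathbb F_q^{d-1}\}\subset\mathbb F_q^{n}$$ be the flat disk. Let $d\sigma$ be the normalized surface measure on $\mathcal F$, which gives mass $1/|\mathcal F|$ to each point of $\mathcal F$, and let $dm$ be counting measure on $\mathbb F_q^n$. For $f:\mathcal F\to\mathbb C$ and $g:\mathbb F_q^n\to\mathbb C$ put $$(f\,d\sigma)^\vee(m)=\frac1{|\mathcal F|}\sum_{x\in\mathcal F}\chi(x\cdot m)f(x),\qquad \widehat g(x)=\sum_{m\in\mathbb F_q^n}\chi(-x\cdot m)g(m),$$ and write $(d\sigma)^\vee=(1\,d\sigma)^\vee$. Let $R^*_{\mathcal F}(p\to r)$ be the smallest constant $R$ such that $\|(f\,d\sigma)^\vee\|_{L^r(\mathbb F_q^n,dm)}\le R\,\|f\|_{L^p(\mathcal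 F,d\sigma)}$ for all $f$, and let $R_{\mathcal F}(t\to s)$ be the smallest constant $R$ such that $\|\widehat g\|_{L^s(\mathcal F,d\sigma)}\le R\,\|g\|_{L^t(\mathbb F_q^n,dm)}$ for all $g$. Write $A\lesssim B$ if $A\le CB$ with a constant $C$ that may depend on $n$ but not on the field $\mathbb F_q$, and $A\sim B$ if $A\lesssim B$ and $B\lesssim A$. Then the following hold. 1. (Extension estimate) $R^*_{\mathcal F}\left(2\to\frac{2n+4}{n-2}\right)\lesssim 1$. 2. (Restriction estimate) $R_{\mathcal F}\left(\frac{2n+4}{n+6}\to 2\right)\lesssim 1$, that is, $\|\widehat g\|_{L^2(\mathcal F,d\sigma)}\lesssim\|g\|_{L^{(2n+4)/(n+6)}(\mathbb F_q^n,dm)}$ for all $g$. It is equivalent to the first estimate: for every $\mathbb F_q$ with $q$ odd, $R^*_{\mathcal F}\left(2\to\frac{2n+4}{n-2}\right)=R_{\mathcal F}\left(\frac{2n+4}{n+6}\to2\right)$. 3. (Sharpness) If $1\le r<\frac{2n+4}{n-2}$, then $R^*_{\mathcal F}(2\to r)\to\infty$ as $q\to\infty$ through the odd prime powers; and if $\frac{2n+4}{n+6}<t\le\infty$,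 then $R_{\mathcal F}(t\to2)\to\infty$ as $q\to\infty$ through the odd prime powers. 4. (Failure of the Stein–Tomas argument) For every $\mathbb F_q$ with $q$ odd, $|\mathcal F|=q^{n-2}$ and $\max_{m\ne\mathbf 0}|(d\sigma)^\vee(m)|=q^{-(n-2)/4}$. The Stein–Tomas lemma says that if $0<k,s<n$ are integers with $|\mathcal F|\sim q^s$ and $\max_{m\neq\mathbf 0}|(d\sigma)^\vee(m)|\lesssim q^{-k/2}$, then $R^*_{\mathcal F}(2\to r)\lesssim1$ for all $r\ge 2+\frac{4(n-s)}{k}$. The smallest value of $2+\frac{4(n-s)}{k}$ over all pairs $(k,s)$ that satisfy these hypotheses is $\frac{2n+12}{n-2}$, which is strictly larger than $\frac{2n+4}{n-2}$. -/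

import Mathlib

open MeasureTheory
open scoped ENNReal NNReal

universe u

namespace FlatDisk

noncomputable section

section Character

variable (F : Type u) [Field F] [Finite F]

instance neZero_ringChar : NeZero (ringChar F) :=
  ⟨CharP.ringChar_ne_zero_of_finite F⟩

/-- The canonical additive character `c ↦ exp (2 π i Tr(c) / p)` of a finite field of
characteristic `p`, where `Tr` is the trace to the prime field. -/
def canonicalChar : AddChar F ℂ :=
  letI : Algebra (ZMod (ringChar F)) F := ZMod.algebra F (ringChar F)
  ZMod.stdAddChar.compAddMonoidHom
    (Algebra.trace (ZMod (ringChar F)) F).toAddMonoidHom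

end Character

variable (F : Type u) [Field F] [Fintype F] (d : ℕ)

/-- The vector `(α, α ⬝ α, β, α ⬝ β)` of `F ^ (2 d)`, for `α, β` in `F ^ (d - 1)`. -/
def diskPoint {F : Type u} [Field F] {d : ℕ} (α β : Fin (d - 1) → F) : Fin (2 * d) → F :=
  fun i =>
    if h : (i : ℕ) < d - 1 then α ⟨i, h⟩
    else if (i : ℕ) = d - 1 then α ⬝ᵥ α
    else if h : (i : ℕ) - d < d - 1 then β ⟨i - d, h⟩
    else α ⬝ᵥ β

/-- The flat disk in `F ^ (2 d)`. -/
def flatDisk : Set (Fin (2 * d) → F) :=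
  {x | ∃ α β : Fin (d - 1) → F, x = diskPoint α β}

instance fintypeFlatDisk : Fintype (flatDisk F d) := Fintype.ofFinite _

/-- Counting measure on `F ^ (2 d)` (every set is measurable). -/
def countingMeasure : @Measure (Fin (2 * d) → F) ⊤ :=
  @Measure.count _ ⊤

/-- The normalized surface measure on the flat disk: mass `1 / |flatDisk|` at every point
(every set is measurable). -/
def surfaceMeasure : @Measure (flatDisk F d) ⊤ :=
  (Fintype.card (flatDisk F d) : ℝ≥0∞)⁻¹ • @Measure.count _ ⊤

variable {F d}

/-- The inverse Fourier transform `(f dσ)^∨` of the measure `f dσ`. -/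
def extension (f : flatDisk F d → ℂ) (m : Fin (2 * d) → F) : ℂ :=
  (Fintype.card (flatDisk F d) : ℂ)⁻¹ *
    ∑ x : flatDisk F d, canonicalChar F ((x : Fin (2 * d) → F) ⬝ᵥ m) * f x

/-- The Fourier transform of a function on `F ^ (2 d)`. -/
def fourier (g : (Fin (2 * d) → F) → ℂ) (x : Fin (2 * d) → F) : ℂ :=
  ∑ m : Fin (2 * d) → F, canonicalChar F (-(x ⬝ᵥ m)) * g m

variable (F d)

/-- `(dσ)^∨`, the inverse Fourier transform of the surface measure. -/
def surfaceMeasureInv (m : Fin (2 * d) → F) : ℂ :=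
  extension (fun _ : flatDisk F d => (1 : ℂ)) m

/-- `R*(p → r)`: the smallest constant in the extension estimate
`‖(f dσ)^∨‖_{L^r(dm)} ≤ C ‖f‖_{L^p(dσ)}`. -/
def extensionConst (p r : ℝ≥0∞) : ℝ≥0∞ :=
  sInf {C : ℝ≥0∞ | ∀ f : flatDisk F d → ℂ,
    eLpNorm (extension f) r (countingMeasure F d) ≤ C * eLpNorm f p (surfaceMeasure F d)}

/-- The smallest constant in the restriction estimate
`‖ĝ‖_{L^s(dσ)} ≤ C ‖g‖_{L^t(dm)}`. -/
def restrictionConst (t s : ℝ≥0∞) : ℝ≥0∞ :=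
  sInf {C : ℝ≥0∞ | ∀ g : (Fin (2 * d) → F) → ℂ,
    eLpNorm (fun x : flatDisk F d => fourier g x) s (surfaceMeasure F d) ≤
      C * eLpNorm g t (countingMeasure F d)}

/-- The exponents `2 + 4 (n - s) / k` (with `n = 2 d`) that the Stein–Tomas lemma yields for the
flat disk: `0 < s, k < n` are integers such that, uniformly over all finite fields of odd order
`q`, the flat disk has size `∼ q ^ s` and its surface measure has Fourier decay
`≲ q ^ (- k / 2)`. -/
def steinTomasExponents (d : ℕ) : Set ℝ :=
  {r | ∃ s k : ℕ, 0 < s ∧ s < 2 * d ∧ 0 < k ∧ k < 2 * d ∧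
    (∃ c C : ℝ, 0 < c ∧ 0 < C ∧
      ∀ (F : Type u) [Field F] [Fintype F], Odd (Fintype.card F) →
        c * (Fintype.card F : ℝ) ^ s ≤ (Fintype.card (flatDisk F d) : ℝ) ∧
        (Fintype.card (flatDisk F d) : ℝ) ≤ C * (Fintype.card F : ℝ) ^ s) ∧
    (∃ C : ℝ, 0 < C ∧
      ∀ (F : Type u) [Field F] [Fintype F], Odd (Fintype.card F) →
        ∀ m : Fin (2 * d) → F, m ≠ 0 →
          ‖surfaceMeasureInv F d m‖ ≤ C * (Fintype.card F : ℝ) ^ (-(k : ℝ) / 2)) ∧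
    r = 2 + 4 * (((2 * d : ℕ) : ℝ) - s) / k}

end

end FlatDisk

namespace FlatDisk

open Complex ComplexConjugate

/-! Write `d = k + 1` and a frequency as `(a, s, b, t)`. Summing over `β` first in `(dσ)^∨` leaves
only those `α` with `b + t α = 0`. Hence `(dσ)^∨` has modulus `q^(-k)` when `t ≠ 0`, vanishes when
`t = 0` and `b ≠ 0`, and for `b = 0`, `t = 0` is the transform of a paraboloid, of modulus
`q^(-k/2)` when `s ≠ 0`. The poor decay `q^(-k/2)` thus occurs only on a small subspace, and
Stein–Tomas loses by using it everywhere.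

The form `‖ĝ‖²` has convolution kernel `(dσ)^∨ = ((dσ)^∨ - P) + (P - δ₀) + δ₀`, where `P`
(`paraboloidKernel`) is the part on that subspace. `P` is itself the transform of a measure on
paraboloid × `F^(k+1)`. By Plancherel the first two pieces have `ℓ² × ℓ²` bounds `2q²` and `2q`;
their sup bounds are `q^(-k)` and `q^(-k/2)`. Riesz–Thorin with the same `θ = 2/(k+2)` removes every
power of `q` from both, and the `δ₀` term is at most `‖g‖_p²` because `p ≤ 2`
(`sumNorm_fourier_le`).

Extension follows by duality with equal constants (`adjoint_bound_iff`). Sharpness is tested on the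
subspace `α = 0` contained in the disk and on its annihilator `b = 0`. -/

/-- The `ℓ^p` norm of a function on a finite type. -/
noncomputable def sumNorm {X : Type*} [Fintype X] (p : ℝ) (f : X → ℂ) : ℝ :=
  (∑ x, ‖f x‖ ^ p) ^ (1 / p)

/-! ### Finite `ℓ^p` norms. -/

section SumNorm

variable {X : Type*} [Fintype X]

theorem sum_norm_rpow_nonneg (p : ℝ) (f : X → ℂ) : 0 ≤ ∑ x, ‖f x‖ ^ p :=
  Finset.sum_nonneg fun _ _ => Real.rpow_nonneg (norm_nonneg _) _

theorem sumNorm_nonneg (p : ℝ) (f : X → ℂ) : 0 ≤ sumNorm p f :=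
  Real.rpow_nonneg (sum_norm_rpow_nonneg p f) _

theorem sumNorm_rpow {p : ℝ} (hp : 0 < p) (f : X → ℂ) :
    sumNorm p f ^ p = ∑ x, ‖f x‖ ^ p := by
  rw [sumNorm, ← Real.rpow_mul (sum_norm_rpow_nonneg p f), one_div_mul_cancel hp.ne', Real.rpow_one]

theorem sumNorm_conj (p : ℝ) (f : X → ℂ) : sumNorm p (fun x => conj (f x)) = sumNorm p f := by
  simp [sumNorm]

theorem sumNorm_two (f : X → ℂ) : sumNorm 2 f = √(∑ x, ‖f x‖ ^ 2) := by
  rw [sumNorm, Real.sqrt_eq_rpow]; norm_cast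

theorem norm_le_sumNorm {p : ℝ} (hp : 0 < p) (f : X → ℂ) (x : X) : ‖f x‖ ≤ sumNorm p f := by
  have h : ‖f x‖ ^ p ≤ ∑ x, ‖f x‖ ^ p :=
    Finset.single_le_sum (f := fun x => ‖f x‖ ^ p)
      (fun _ _ => Real.rpow_nonneg (norm_nonneg _) _) (Finset.mem_univ x)
  rw [← sumNorm_rpow hp] at h
  exact (Real.rpow_le_rpow_iff (norm_nonneg _) (sumNorm_nonneg p f) hp).1 h

/-- Split `‖f x‖² = ‖f x‖^p ‖f x‖^(2-p)` and bound the second factor by the `ℓ^p` norm. -/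
theorem sumNorm_two_le {p : ℝ} (hp : 0 < p) (hp2 : p ≤ 2) (f : X → ℂ) :
    sumNorm 2 f ≤ sumNorm p f := by
  have h0 := sumNorm_nonneg p f
  refine (Real.rpow_le_rpow_iff (sumNorm_nonneg 2 f) h0 (z := 2) two_pos).1 ?_
  rw [sumNorm_rpow two_pos]
  have : sumNorm p f ^ (2 : ℝ) = ∑ x, ‖f x‖ ^ p * sumNorm p f ^ (2 - p) := by
    rw [← Finset.sum_mul, ← sumNorm_rpow hp, ← Real.rpow_add_of_nonneg h0 hp.le (by linarith)]
    congr 1; ring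
  rw [this]
  refine Finset.sum_le_sum fun x _ => ?_
  calc ‖f x‖ ^ (2 : ℝ) = ‖f x‖ ^ p * ‖f x‖ ^ (2 - p) := by
        rw [← Real.rpow_add_of_nonneg (norm_nonneg _) hp.le (by linarith)]; congr 1; ring
    _ ≤ _ := by
        have := norm_le_sumNorm hp f x
        have : 0 ≤ 2 - p := by linarith
        gcongr

theorem norm_sum_mul_le {p q : ℝ} (h : p.HolderConjugate q) (f g : X → ℂ) :
    ‖∑ x, f x * g x‖ ≤ sumNorm p f * sumNorm q g := by
  refine (norm_sum_le _ _).trans ?_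
  simp only [norm_mul]
  exact Real.inner_le_Lp_mul_Lq_of_nonneg _ h (fun _ _ => norm_nonneg _) fun _ _ => norm_nonneg _

theorem eLpNorm_count_eq [MeasurableSpace X] [MeasurableSingletonClass X] {p : ℝ} (hp : 0 < p)
    (f : X → ℂ) :
    eLpNorm f (ENNReal.ofReal p) Measure.count = ENNReal.ofReal (sumNorm p f) := by
  rw [eLpNorm_eq_lintegral_rpow_enorm_toReal (by simpa using hp) ENNReal.ofReal_ne_top,
    ENNReal.toReal_ofReal hp.le, lintegral_count, tsum_fintype, sumNorm,
    ← ENNReal.ofReal_rpow_of_nonneg (sum_norm_rpow_nonneg p f) (by positivity),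
    ENNReal.ofReal_sum_of_nonneg fun _ _ => Real.rpow_nonneg (norm_nonneg _) _]
  congr 1
  refine Finset.sum_congr rfl fun x _ => ?_
  rw [← ofReal_norm, ENNReal.ofReal_rpow_of_nonneg (norm_nonneg _) hp.le]

end SumNorm

/-! ### Riesz–Thorin for bilinear forms, by the three lines theorem. -/

section Interpolation

variable {X : Type*}

theorem norm_div_norm_le_one (z : ℂ) : ‖z / (‖z‖ : ℂ)‖ ≤ 1 := by
  rw [norm_div, norm_real, norm_norm]; exact div_self_le_one _

/-- The analytic family through a function used in the Riesz–Thorin argument. -/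
noncomputable def analyticFamily (p : ℝ) (f : X → ℂ) (z : ℂ) (x : X) : ℂ :=
  f x / (‖f x‖ : ℂ) * exp ((Real.log ‖f x‖ * (p / 2) : ℝ) * (1 + z))

/-- The exponent is `p/2` on `re z = 0` and `p` on `re z = 1`, so the `ℓ²` norm on one edge and the
`ℓ¹` norm on the other are powers of `∑ ‖f x‖^p`. Zeros of `f` are separate: there the phase is `0 /
0 = 0`. -/
theorem norm_analyticFamily (p : ℝ) (f : X → ℂ) (z : ℂ) (x : X) :
    ‖analyticFamily p f z x‖ = if f x = 0 then 0 else ‖f x‖ ^ (p / 2 * (1 + z.re)) := by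
  unfold analyticFamily
  split_ifs with h
  · simp [h]
  · have h' : ‖f x‖ ≠ 0 := by simpa using h
    rw [norm_mul, norm_div, norm_real, norm_norm, div_self h', one_mul, norm_exp,
      Real.rpow_def_of_pos (by positivity), re_ofReal_mul, add_re, one_re, mul_assoc]

theorem analyticFamily_eq {p θ : ℝ} (h : p / 2 * (1 + θ) = 1) (f : X → ℂ) (x : X) :
    analyticFamily p f θ x = f x := by
  unfold analyticFamily
  by_cases hx : f x = 0
  · simp [hx]
  · have h' : 0 < ‖f x‖ := by simpa using hx
    have e : ((Real.log ‖f x‖ * (p / 2) : ℝ) * (1 + (θ : ℂ))) = ((Real.log ‖f x‖ : ℝ) : ℂ) := by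
      have h' : (p : ℂ) / 2 * (1 + θ) = 1 := by exact_mod_cast h
      push_cast
      rw [mul_assoc, h', mul_one]
    rw [e, ← ofReal_exp, Real.exp_log h', div_mul_cancel₀ _ (by simpa using hx)]

theorem differentiable_analyticFamily (p : ℝ) (f : X → ℂ) (x : X) :
    Differentiable ℂ fun z => analyticFamily p f z x := by
  unfold analyticFamily; fun_prop

variable [Fintype X]

theorem norm_analyticFamily_le (p : ℝ) (f : X → ℂ) :
    ∃ M : ℝ, 0 ≤ M ∧ ∀ z : ℂ, z.re ∈ Set.Icc (0 : ℝ) 1 → ∀ x, ‖analyticFamily p f z x‖ ≤ M := by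
  refine ⟨∑ x, Real.exp (2 * |Real.log ‖f x‖ * (p / 2)|),
    Finset.sum_nonneg fun _ _ => (Real.exp_pos _).le, fun z hz x => ?_⟩
  refine le_trans ?_ (Finset.single_le_sum
    (f := fun x => Real.exp (2 * |Real.log ‖f x‖ * (p / 2)|))
      (fun _ _ => (Real.exp_pos _).le) (Finset.mem_univ x))
  unfold analyticFamily
  rw [norm_mul, norm_exp, re_ofReal_mul, add_re, one_re]
  refine (mul_le_of_le_one_left (Real.exp_pos _).le (norm_div_norm_le_one _)).trans ?_
  refine Real.exp_le_exp.2 ?_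
  obtain ⟨h0, h1⟩ := hz
  calc _ ≤ |Real.log ‖f x‖ * (p / 2)| * (1 + z.re) := by
        gcongr; exact le_abs_self _
    _ ≤ |Real.log ‖f x‖ * (p / 2)| * 2 := by gcongr; linarith
    _ = _ := mul_comm _ _

theorem norm_form_le_of_norm_le (K : X → X → ℂ) {A : ℝ} (h : ∀ x y, ‖K x y‖ ≤ A) (f g : X → ℂ) :
    ‖∑ x, ∑ y, K x y * f x * g y‖ ≤ A * (∑ x, ‖f x‖) * ∑ y, ‖g y‖ := by
  calc _ ≤ ∑ x, ∑ y, A * ‖f x‖ * ‖g y‖ := by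
        refine (norm_sum_le _ _).trans (Finset.sum_le_sum fun x _ => ?_)
        refine (norm_sum_le _ _).trans (Finset.sum_le_sum fun y _ => ?_)
        rw [norm_mul, norm_mul]
        gcongr
        exact h x y
    _ = _ := by simp only [Finset.mul_sum, Finset.sum_mul]; rw [Finset.sum_comm]

/-- Riesz–Thorin interpolation of bilinear forms between `ℓ^1 × ℓ^1` and `ℓ^2 × ℓ^2`. -/
theorem norm_form_le_interp (K : X → X → ℂ) {A B θ p : ℝ} (hA : 0 ≤ A) (hB : 0 ≤ B)
    (hθ0 : 0 ≤ θ) (hθ1 : θ ≤ 1) (hp0 : 0 < p) (hp : p / 2 * (1 + θ) = 1)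
    (h1 : ∀ x y, ‖K x y‖ ≤ A)
    (h2 : ∀ f g : X → ℂ, ‖∑ x, ∑ y, K x y * f x * g y‖ ≤ B * sumNorm 2 f * sumNorm 2 g)
    (f g : X → ℂ) :
    ‖∑ x, ∑ y, K x y * f x * g y‖ ≤ B ^ (1 - θ) * A ^ θ * sumNorm p f * sumNorm p g := by
  -- The form is bilinear, without conjugates, so `Φ` is entire.
  set Φ : ℂ → ℂ := fun z =>
    ∑ x, ∑ y, K x y * analyticFamily p f z x * analyticFamily p g z y with hΦ
  set S := ∑ x, ‖f x‖ ^ p with hS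
  set T := ∑ x, ‖g x‖ ^ p with hT
  have hS0 : 0 ≤ S := sum_norm_rpow_nonneg p f
  have hT0 : 0 ≤ T := sum_norm_rpow_nonneg p g
  have hdiff : Differentiable ℂ Φ := by
    have := differentiable_analyticFamily p f
    have := differentiable_analyticFamily p g
    fun_prop
  have hbdd : BddAbove ((norm ∘ Φ) '' HadamardThreeLines.verticalClosedStrip 0 1) := by
    obtain ⟨M, hM0, hM⟩ := norm_analyticFamily_le p f
    obtain ⟨N, hN0, hN⟩ := norm_analyticFamily_le p g
    refine ⟨A * (∑ _x : X, M) * ∑ _y : X, N, ?_⟩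
    rintro _ ⟨z, hz, rfl⟩
    refine (norm_form_le_of_norm_le K h1 _ _).trans ?_
    gcongr with x _ y _
    · exact hM z hz x
    · exact hN z hz y
  have e0 : ∀ (f : X → ℂ) (z : ℂ), z.re = 0 →
      sumNorm 2 (analyticFamily p f z) = (∑ x, ‖f x‖ ^ p) ^ (1 / 2 : ℝ) := by
    intro f z hz
    rw [sumNorm]
    congr 1
    refine Finset.sum_congr rfl fun x _ => ?_
    rw [norm_analyticFamily, hz]
    split_ifs with h
    · simp [h, hp0.ne']
    · rw [← Real.rpow_mul (norm_nonneg _)]; congr 1; ring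
  have e1 : ∀ (f : X → ℂ) (z : ℂ), z.re = 1 →
      ∑ x, ‖analyticFamily p f z x‖ = ∑ x, ‖f x‖ ^ p := by
    intro f z hz
    refine Finset.sum_congr rfl fun x _ => ?_
    rw [norm_analyticFamily, hz]
    split_ifs with h
    · simp [h, hp0.ne']
    · congr 1; ring
  have key := HadamardThreeLines.norm_le_interp_of_mem_verticalClosedStrip' (f := Φ) (z := θ)
    (a := B * S ^ (1 / 2 : ℝ) * T ^ (1 / 2 : ℝ)) (b := A * S * T) one_pos
    (by simp [HadamardThreeLines.verticalClosedStrip, hθ0, hθ1]) hdiff.diffContOnCl hbdd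
    (fun z hz => by
      have hz : z.re = 0 := hz
      refine (h2 _ _).trans ?_
      rw [e0 f z hz, e0 g z hz])
    (fun z hz => by
      have hz : z.re = 1 := hz
      refine (norm_form_le_of_norm_le K h1 _ _).trans ?_
      rw [e1 f z hz, e1 g z hz])
  have hΦθ : Φ θ = ∑ x, ∑ y, K x y * f x * g y := by
    simp only [hΦ, analyticFamily_eq hp]
  rw [hΦθ] at key
  refine key.trans (le_of_eq ?_)
  simp only [ofReal_re, sub_zero, div_one]
  -- This is the interpolation relation between the exponents `2` and `1`.
  have hexp : 1 / p = 1 / 2 * (1 - θ) + θ := by field_simp; linarith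
  have comb : ∀ S : ℝ, 0 ≤ S → (S ^ (1 / 2 : ℝ)) ^ (1 - θ) * S ^ θ = S ^ (1 / p) := by
    intro S hS
    rw [← Real.rpow_mul hS, hexp, ← Real.rpow_add_of_nonneg hS _ hθ0]
    exact mul_nonneg (by norm_num) (by linarith)
  have hs := Real.rpow_nonneg hS0 (1 / 2)
  have ht := Real.rpow_nonneg hT0 (1 / 2)
  rw [Real.mul_rpow (by positivity) ht, Real.mul_rpow hB hs, Real.mul_rpow (by positivity) hT0,
    Real.mul_rpow hA hS0]
  unfold sumNorm
  rw [← hS, ← hT, ← comb S hS0, ← comb T hT0]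
  ring

end Interpolation

/-! ### Duality between extension and restriction. -/

section Duality

variable {X M : Type*} [Fintype X] [Fintype M]

/-- The adjoint of an operator is bounded from `L^2` to `ℓ^r` with the constant with which the
operator is bounded from `ℓ^s` to `L^2`, where `r` and `s` are conjugate exponents. -/
theorem adjoint_bound_iff (K : X → M → ℂ) {c r s : ℝ} (hc : 0 ≤ c) (hrs : r.HolderConjugate s)
    (C : ℝ≥0∞) :
    (∀ f : X → ℂ, ENNReal.ofReal (sumNorm r fun m => c * ∑ x, conj (K x m) * f x) ≤
      C * ENNReal.ofReal (√c * sumNorm 2 f)) ↔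
    ∀ g : M → ℂ, ENNReal.ofReal (√c * sumNorm 2 fun x => ∑ m, K x m * g m) ≤
      C * ENNReal.ofReal (sumNorm s g) := by
  have hr := hrs.pos
  have hs := hrs.symm.pos
  have adj : ∀ (f : X → ℂ) (g : M → ℂ), ∑ m, g m * conj (c * ∑ x, conj (K x m) * f x) =
      c * ∑ x, (∑ m, K x m * g m) * conj (f x) := by
    intro f g
    simp only [map_mul, map_sum, conj_conj, conj_ofReal, Finset.mul_sum, Finset.sum_mul]
    rw [Finset.sum_comm]
    refine Finset.sum_congr rfl fun x _ => Finset.sum_congr rfl fun m _ => ?_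
    ring
  constructor
  · intro H g
    set h : X → ℂ := fun x => ∑ m, K x m * g m with hh
    set Y := √c * sumNorm 2 h with hY
    have hY0 : 0 ≤ Y := mul_nonneg (Real.sqrt_nonneg _) (sumNorm_nonneg _ _)
    -- `T* T` argument: pair `g` with the adjoint applied to `h = T g`. One factor `Y` then cancels;
    -- it must be nonzero, hence the case split below.
    have sq : Y * Y ≤ sumNorm s g * sumNorm r fun m => c * ∑ x, conj (K x m) * h x := by
      have h1 := norm_sum_mul_le hrs.symm g (fun m => conj (c * ∑ x, conj (K x m) * h x))
      rw [sumNorm_conj r (fun m => (c : ℂ) * ∑ x, conj (K x m) * h x), adj] at h1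
      refine le_trans (le_of_eq ?_) h1
      have : ∑ x, h x * conj (h x) = ((sumNorm 2 h ^ 2 : ℝ) : ℂ) := by
        rw [sumNorm_two, Real.sq_sqrt (by positivity)]
        push_cast
        exact Finset.sum_congr rfl fun x _ => mul_conj' _
      rw [show (∑ x, (∑ m, K x m * g m) * conj (h x)) = ∑ x, h x * conj (h x) from rfl, this,
        norm_mul, norm_real, norm_real, Real.norm_of_nonneg hc, Real.norm_of_nonneg (sq_nonneg _),
        hY]
      nlinarith [Real.mul_self_sqrt hc]
    rcases hY0.eq_or_lt with h0 | h0
    · rw [← h0]; simp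
    have h3 : ENNReal.ofReal Y * ENNReal.ofReal Y ≤
        (C * ENNReal.ofReal (sumNorm s g)) * ENNReal.ofReal Y := by
      rw [← ENNReal.ofReal_mul hY0]
      refine (ENNReal.ofReal_le_ofReal sq).trans ?_
      rw [ENNReal.ofReal_mul (sumNorm_nonneg _ _)]
      calc _ ≤ ENNReal.ofReal (sumNorm s g) * (C * ENNReal.ofReal Y) := by gcongr; exact H h
        _ = _ := by ring
    exact (ENNReal.mul_le_mul_iff_left (by simpa using h0) ENNReal.ofReal_ne_top).1 h3
  · intro H f
    set h : M → ℂ := fun m => c * ∑ x, conj (K x m) * f x with hh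
    set Y := sumNorm r h with hY
    have hY0 : 0 ≤ Y := sumNorm_nonneg _ _
    rcases hY0.eq_or_lt with h0 | h0
    · rw [← h0]; simp
    -- The extremal function of Hölder's inequality: its pairing with `h` is `Y^r`, while its `ℓ^s`
    -- norm is `Y^(r-1)`.
    set g : M → ℂ := fun m => h m * (‖h m‖ ^ (r - 2) : ℝ) with hg
    have gnorm : ∀ m, ‖g m‖ = ‖h m‖ ^ (r - 1) := by
      intro m
      rw [hg, norm_mul, norm_real, Real.norm_of_nonneg (Real.rpow_nonneg (norm_nonneg _) _)]
      rcases eq_or_ne (h m) 0 with hm | hm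
      · have : r - 1 ≠ 0 := hrs.sub_one_ne_zero
        simp [hm, this]
      · have hm' : 0 < ‖h m‖ := by simpa using hm
        nth_rewrite 1 [← Real.rpow_one ‖h m‖]
        rw [← Real.rpow_add hm']; congr 1; ring
    have hgs : sumNorm s g = Y ^ (r - 1) := by
      have e : ∑ m, ‖g m‖ ^ s = ∑ m, ‖h m‖ ^ r := by
        refine Finset.sum_congr rfl fun m _ => ?_
        rw [gnorm, ← Real.rpow_mul (norm_nonneg _)]
        congr 1
        have := hrs.sub_one_mul_conj
        linarith
      rw [sumNorm, e, hY, sumNorm, ← Real.rpow_mul (sum_norm_rpow_nonneg r h)]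
      congr 1
      have := hrs.sub_one_mul_conj
      field_simp
      linarith
    have main : Y ^ (r - 1) * Y ≤ (√c * sumNorm 2 fun x => ∑ m, K x m * g m) *
        (√c * sumNorm 2 f) := by
      have h1 : Y ^ (r - 1) * Y = ‖(c : ℂ) * ∑ x, (∑ m, K x m * g m) * conj (f x)‖ := by
        rw [← adj, show Y ^ (r - 1) * Y = Y ^ r by
          nth_rewrite 2 [← Real.rpow_one Y]
          rw [← Real.rpow_add h0]; congr 1; ring, hY, sumNorm_rpow hr]
        have : ∑ m, g m * conj (c * ∑ x, conj (K x m) * f x) = ((∑ m, ‖h m‖ ^ r : ℝ) : ℂ) := by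
          push_cast
          refine Finset.sum_congr rfl fun m _ => ?_
          change h m * _ * conj (h m) = _
          rw [mul_right_comm, mul_conj']
          norm_cast
          rcases eq_or_ne (h m) 0 with hm | hm
          · simp [hm, hr.ne']
          · have hm' : 0 < ‖h m‖ := by simpa using hm
            rw [← Real.rpow_natCast, ← Real.rpow_add hm']; congr 1; push_cast; ring
        rw [this, norm_real, Real.norm_of_nonneg (sum_norm_rpow_nonneg r h)]
      rw [h1, norm_mul, norm_real, Real.norm_of_nonneg hc]
      have h2 := norm_sum_mul_le (p := 2) (q := 2) Real.HolderConjugate.two_two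
        (fun x => ∑ m, K x m * g m) (fun x => conj (f x))
      rw [sumNorm_conj] at h2
      refine (mul_le_mul_of_nonneg_left h2 hc).trans (le_of_eq ?_)
      nth_rewrite 1 [← Real.mul_self_sqrt hc]
      ring
    have hYp : 0 < Y ^ (r - 1) := Real.rpow_pos_of_pos h0 _
    have h3 : ENNReal.ofReal (Y ^ (r - 1)) * ENNReal.ofReal Y ≤
        ENNReal.ofReal (Y ^ (r - 1)) * (C * ENNReal.ofReal (√c * sumNorm 2 f)) := by
      rw [← ENNReal.ofReal_mul hYp.le]
      refine (ENNReal.ofReal_le_ofReal main).trans ?_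
      rw [ENNReal.ofReal_mul (mul_nonneg (Real.sqrt_nonneg _) (sumNorm_nonneg _ _))]
      calc _ ≤ (C * ENNReal.ofReal (sumNorm s g)) * ENNReal.ofReal (√c * sumNorm 2 f) := by
            gcongr; exact H g
        _ = _ := by rw [hgs]; ring
    exact (ENNReal.mul_le_mul_iff_right (by simpa using hYp) ENNReal.ofReal_ne_top).1 h3

end Duality

end FlatDisk

namespace FlatDisk

open ComplexConjugate

/-! ### Character sums, Plancherel and Gauss sums. -/

section Orthogonality

variable {F : Type u} [Field F] [Fintype F]

/-- Nondegeneracy of the trace form gives an element of nonzero trace, and the standard character of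
the prime field is injective. -/
theorem canonicalChar_isPrimitive : (canonicalChar F).IsPrimitive := by
  apply AddChar.IsPrimitive.of_ne_one
  let _ : Algebra (ZMod (ringChar F)) F := ZMod.algebra F (ringChar F)
  obtain ⟨b, hb⟩ := FiniteField.trace_to_zmod_nondegenerate F (one_ne_zero (α := F))
  rw [one_mul] at hb
  intro h
  apply hb
  apply ZMod.injective_stdAddChar
  rw [AddChar.map_zero_eq_one]
  exact DFunLike.congr_fun h b

theorem norm_canonicalChar (x : F) : ‖canonicalChar F x‖ = 1 := AddChar.norm_apply _ _

variable {ι : Type*} [Fintype ι] [DecidableEq ι]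

open scoped Classical in
theorem sum_canonicalChar_dotProduct (v : ι → F) :
    ∑ x : ι → F, canonicalChar F (x ⬝ᵥ v) =
      if v = 0 then (Fintype.card F : ℂ) ^ Fintype.card ι else 0 := by
  have h : ∑ x : ι → F, canonicalChar F (x ⬝ᵥ v) = ∏ i, ∑ c : F, canonicalChar F (c * v i) := by
    rw [Finset.prod_univ_sum, Fintype.piFinset_univ]
    refine Finset.sum_congr rfl fun x _ => ?_
    exact map_prod (canonicalChar F).toMonoidHom _ Finset.univ
  rw [h]
  simp only [AddChar.sum_mulShift _ canonicalChar_isPrimitive]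
  split_ifs with hv
  · simp [hv]
  · obtain ⟨i, hi⟩ := Function.ne_iff.1 hv
    exact Finset.prod_eq_zero (Finset.mem_univ i) (by simpa using hi)

theorem sum_norm_sq_fourier (f : (ι → F) → ℂ) :
    ∑ ξ : ι → F, ‖∑ m, canonicalChar F (ξ ⬝ᵥ m) * f m‖ ^ 2 =
      (Fintype.card F : ℝ) ^ Fintype.card ι * ∑ m, ‖f m‖ ^ 2 := by
  classical
  have h : (∑ ξ : ι → F, (‖∑ m, canonicalChar F (ξ ⬝ᵥ m) * f m‖ : ℂ) ^ 2) =
      (Fintype.card F : ℂ) ^ Fintype.card ι * ∑ m, (‖f m‖ : ℂ) ^ 2 := by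
    calc _ = ∑ ξ : ι → F, ∑ m, ∑ m', canonicalChar F (ξ ⬝ᵥ (m - m')) * (f m * conj (f m')) := by
          refine Finset.sum_congr rfl fun ξ _ => ?_
          rw [← Complex.mul_conj', map_sum, Finset.sum_mul_sum]
          refine Finset.sum_congr rfl fun m _ => Finset.sum_congr rfl fun m' _ => ?_
          rw [map_mul, ← AddChar.map_neg_eq_conj, dotProduct_sub, sub_eq_add_neg,
            AddChar.map_add_eq_mul]
          ring
      _ = ∑ m, ∑ m', (∑ ξ : ι → F, canonicalChar F (ξ ⬝ᵥ (m - m'))) * (f m * conj (f m')) := by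
          rw [Finset.sum_comm]
          refine Finset.sum_congr rfl fun m _ => ?_
          rw [Finset.sum_comm]
          simp only [Finset.sum_mul]
      _ = _ := by
          rw [Finset.mul_sum]
          refine Finset.sum_congr rfl fun m _ => ?_
          simp only [sum_canonicalChar_dotProduct, sub_eq_zero, ite_mul, zero_mul,
            Finset.sum_ite_eq, Finset.mem_univ, if_true, Complex.mul_conj']
  exact_mod_cast h

/-- Restricting to the image of `j` drops nonnegative terms from Plancherel. -/
theorem sumNorm_fourier_comp_le {W : Type*} [Fintype W] {j : W → ι → F} (hj : j.Injective)
    (f : (ι → F) → ℂ) :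
    sumNorm 2 (fun w => ∑ m, canonicalChar F (j w ⬝ᵥ m) * f m) ≤
      √((Fintype.card F : ℝ) ^ Fintype.card ι) * sumNorm 2 f := by
  classical
  rw [sumNorm_two, sumNorm_two, ← Real.sqrt_mul (by positivity), ← sum_norm_sq_fourier]
  apply Real.sqrt_le_sqrt
  rw [← Finset.sum_image (s := Finset.univ) (g := j)
    (f := fun ξ => ‖∑ m, canonicalChar F (ξ ⬝ᵥ m) * f m‖ ^ 2) hj.injOn]
  exact Finset.sum_le_sum_of_subset_of_nonneg (Finset.subset_univ _) fun _ _ _ => by positivity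

/-- The inverse Fourier transform of `c` times counting measure on a parametrized set. -/
noncomputable def charKernel {W : Type*} [Fintype W] (c : ℝ) (j : W → ι → F) (m : ι → F) : ℂ :=
  c * ∑ w, canonicalChar F (j w ⬝ᵥ m)

theorem form_charKernel {W : Type*} [Fintype W] (c : ℝ) (j : W → ι → F) (f g : (ι → F) → ℂ) :
    ∑ m, ∑ m', charKernel c j (m' - m) * f m * g m' =
      c * ∑ w, (∑ m, canonicalChar F (-(j w ⬝ᵥ m)) * f m) *
        ∑ m, canonicalChar F (j w ⬝ᵥ m) * g m := by
  calc _ = ∑ m, ∑ m', ∑ w, c * ((canonicalChar F (-(j w ⬝ᵥ m)) * f m) *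
        (canonicalChar F (j w ⬝ᵥ m') * g m')) := by
        refine Finset.sum_congr rfl fun m _ => Finset.sum_congr rfl fun m' _ => ?_
        rw [charKernel, mul_assoc, Finset.mul_sum, Finset.sum_mul]
        refine Finset.sum_congr rfl fun w _ => ?_
        rw [dotProduct_sub, sub_eq_neg_add, AddChar.map_add_eq_mul]
        ring
    _ = _ := by
        rw [Finset.sum_congr rfl fun m _ => Finset.sum_comm, Finset.sum_comm, Finset.mul_sum]
        refine Finset.sum_congr rfl fun w _ => ?_
        rw [Finset.sum_mul_sum, Finset.mul_sum]
        simp only [Finset.mul_sum]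

/-- The convolution form is a pairing of two Fourier transforms on the image of `j`; Cauchy–Schwarz
and Plancherel bound it. -/
theorem norm_form_charKernel_le {W : Type*} [Fintype W] {c : ℝ} (hc : 0 ≤ c) {j : W → ι → F}
    (hj : j.Injective) (f g : (ι → F) → ℂ) :
    ‖∑ m, ∑ m', charKernel c j (m' - m) * f m * g m'‖ ≤
      c * (Fintype.card F : ℝ) ^ Fintype.card ι * sumNorm 2 f * sumNorm 2 g := by
  rw [form_charKernel, norm_mul, Complex.norm_real, Real.norm_of_nonneg hc]
  set N : ℝ := (Fintype.card F : ℝ) ^ Fintype.card ι with hN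
  have hN0 : 0 ≤ N := by positivity
  have hf : sumNorm 2 (fun w => ∑ m, canonicalChar F (-(j w ⬝ᵥ m)) * f m) ≤
      √N * sumNorm 2 f := by
    rw [← sumNorm_conj 2 f, ← sumNorm_conj]
    refine le_trans (le_of_eq ?_) (sumNorm_fourier_comp_le hj _)
    congr 1
    funext w
    rw [map_sum]
    refine Finset.sum_congr rfl fun m _ => ?_
    rw [map_mul, ← AddChar.map_neg_eq_conj, neg_neg]
  have hg := sumNorm_fourier_comp_le hj g
  have := norm_sum_mul_le Real.HolderConjugate.two_two
    (fun w => ∑ m, canonicalChar F (-(j w ⬝ᵥ m)) * f m)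
    (fun w => ∑ m, canonicalChar F (j w ⬝ᵥ m) * g m)
  calc _ ≤ c * ((√N * sumNorm 2 f) * (√N * sumNorm 2 g)) := by
        refine mul_le_mul_of_nonneg_left (this.trans ?_) hc
        exact mul_le_mul hf hg (sumNorm_nonneg _ _)
          (mul_nonneg (Real.sqrt_nonneg _) (sumNorm_nonneg _ _))
    _ = c * (√N * √N) * sumNorm 2 f * sumNorm 2 g := by ring
    _ = _ := by rw [Real.mul_self_sqrt hN0]

/-- Expand `‖G‖²` and substitute `x = z + y`: the terms quadratic in `y` cancel, and the remaining
linear sum over `y` forces `2 s z = 0`, that is `z = 0`. -/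
theorem norm_quadratic_sum {s : F} (h2 : (2 : F) ≠ 0) (hs : s ≠ 0) (a : ι → F) :
    ‖∑ x : ι → F, canonicalChar F (x ⬝ᵥ a + (x ⬝ᵥ x) * s)‖ =
      (Fintype.card F : ℝ) ^ ((Fintype.card ι : ℝ) / 2) := by
  classical
  set G := ∑ x : ι → F, canonicalChar F (x ⬝ᵥ a + (x ⬝ᵥ x) * s) with hG
  have h : (‖G‖ : ℂ) ^ 2 = (Fintype.card F : ℂ) ^ Fintype.card ι := by
    rw [← Complex.mul_conj', hG, map_sum, Finset.sum_mul_sum, Finset.sum_comm]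
    calc _ = ∑ y : ι → F, ∑ z : ι → F, canonicalChar F (z ⬝ᵥ a + (z ⬝ᵥ z) * s) *
          canonicalChar F (y ⬝ᵥ ((2 * s) • z)) := by
          refine Finset.sum_congr rfl fun y _ => ?_
          rw [← Equiv.sum_comp (Equiv.addRight y)]
          refine Finset.sum_congr rfl fun z _ => ?_
          rw [← AddChar.map_neg_eq_conj, ← AddChar.map_add_eq_mul, ← AddChar.map_add_eq_mul]
          congr 1
          simp only [Equiv.coe_addRight, add_dotProduct, dotProduct_add, dotProduct_smul,
            smul_eq_mul, dotProduct_comm z y]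
          ring
      _ = _ := by
          rw [Finset.sum_comm]
          simp only [← Finset.mul_sum, sum_canonicalChar_dotProduct, smul_eq_zero, mul_eq_zero, h2,
            hs, false_or, mul_ite, mul_zero, Finset.sum_ite_eq', Finset.mem_univ, if_true]
          simp
  have h' : ‖G‖ ^ 2 = (Fintype.card F : ℝ) ^ Fintype.card ι := by exact_mod_cast h
  rw [← Real.sqrt_sq (norm_nonneg G), h', Real.sqrt_eq_rpow, ← Real.rpow_natCast_mul (by positivity)]
  congr 1
  ring

end Orthogonality

/-! ### The coordinates `(a, s, b, t)` with `d = k + 1`. -/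

section Coordinates

variable {F : Type u} {k : ℕ}

theorem sum_fin_two_mul_succ {R : Type*} [AddCommMonoid R] (f : Fin (2 * (k + 1)) → R) :
    ∑ i, f i = (∑ i : Fin k, f ⟨i, by omega⟩ + f ⟨k, by omega⟩) +
      (∑ i : Fin k, f ⟨k + 1 + i, by omega⟩ + f ⟨2 * k + 1, by omega⟩) := by
  rw [← (finCongr (show (k + 1) + (k + 1) = 2 * (k + 1) by ring)).sum_comp, Fin.sum_univ_add,
    Fin.sum_univ_castSucc, Fin.sum_univ_castSucc]
  congr 3
  simp [Fin.ext_iff]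
  ring

/-- The vector `(a, s, b, t)`. -/
def join (a : Fin k → F) (s : F) (b : Fin k → F) (t : F) : Fin (2 * (k + 1)) → F :=
  fun i =>
    if h : (i : ℕ) < k then a ⟨i, h⟩
    else if (i : ℕ) = k then s
    else if h : (i : ℕ) - (k + 1) < k then b ⟨i - (k + 1), h⟩
    else t

section

variable (a b : Fin k → F) (s t : F)

@[simp] theorem join_fst (i : Fin k) : join a s b t ⟨i, by omega⟩ = a i := by simp [join]

@[simp] theorem join_snd : join a s b t ⟨k, by omega⟩ = s := by simp [join]

@[simp] theorem join_third (i : Fin k) : join a s b t ⟨k + 1 + i, by omega⟩ = b i := by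
  have h1 : ¬ (k + 1 + (i : ℕ) < k) := by omega
  have h2 : ¬ (k + 1 + (i : ℕ) = k) := by omega
  simp [join, h1, h2]

@[simp] theorem join_fourth : join a s b t ⟨2 * k + 1, by omega⟩ = t := by
  have h1 : ¬ (2 * k + 1 < k) := by omega
  have h2 : ¬ (2 * k + 1 = k) := by omega
  have h3 : ¬ (2 * k + 1 - (k + 1) < k) := by omega
  simp only [join, h1, h2, h3, dif_neg, if_neg, not_false_eq_true]

end

/-- The coordinates `(a, s, b, t)` on `F ^ (2 (k + 1))`. -/
def joinEquiv : ((Fin k → F) × F) × ((Fin k → F) × F) ≃ (Fin (2 * (k + 1)) → F) where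
  toFun p := join p.1.1 p.1.2 p.2.1 p.2.2
  invFun m := ((fun i => m ⟨i, by omega⟩, m ⟨k, by omega⟩),
    (fun i => m ⟨k + 1 + i, by omega⟩, m ⟨2 * k + 1, by omega⟩))
  left_inv p := by simp
  right_inv m := by
    funext i
    simp only [join]
    split_ifs with h1 h2 h3
    · rfl
    · congr 1; exact Fin.ext h2.symm
    · congr 1; apply Fin.ext; simp only; omega
    · congr 1; apply Fin.ext; simp only; omega

theorem exists_eq_join (m : Fin (2 * (k + 1)) → F) : ∃ a s b t, m = join a s b t :=
  ⟨_, _, _, _, (joinEquiv.apply_symm_apply m).symm⟩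

theorem join_inj {a a' b b' : Fin k → F} {s s' t t' : F} :
    join a s b t = join a' s' b' t' ↔ a = a' ∧ s = s' ∧ b = b' ∧ t = t' := by
  have := joinEquiv.injective.eq_iff (a := ((a, s), (b, t))) (b := ((a', s'), (b', t')))
  simpa [joinEquiv, and_assoc] using this

variable [Field F]

theorem join_dotProduct_join (a a' b b' : Fin k → F) (s s' t t' : F) :
    join a s b t ⬝ᵥ join a' s' b' t' = a ⬝ᵥ a' + s * s' + (b ⬝ᵥ b' + t * t') := by
  rw [dotProduct, sum_fin_two_mul_succ]
  simp [dotProduct]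

theorem join_eq_zero {a b : Fin k → F} {s t : F} :
    join a s b t = 0 ↔ a = 0 ∧ s = 0 ∧ b = 0 ∧ t = 0 := by
  have h : join (0 : Fin k → F) 0 0 0 = 0 := by funext i; simp [join]
  rw [← h, join_inj]

theorem diskPoint_eq_join (α β : Fin k → F) :
    diskPoint (d := k + 1) α β = join α (α ⬝ᵥ α) β (α ⬝ᵥ β) := rfl

/-- The parametrization of the flat disk. -/
noncomputable def diskEquiv : (Fin k → F) × (Fin k → F) ≃ flatDisk F (k + 1) :=
  Equiv.ofBijective (fun p => ⟨diskPoint (d := k + 1) p.1 p.2, p.1, p.2, rfl⟩) <| by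
    constructor
    · rintro ⟨α, β⟩ ⟨α', β'⟩ h
      have h := Subtype.ext_iff.1 h
      simp only [diskPoint_eq_join, join_inj] at h
      simp [h.1, h.2.2.1]
    · rintro ⟨x, α, β, rfl⟩
      exact ⟨(α, β), rfl⟩

theorem diskEquiv_coe (p : (Fin k → F) × (Fin k → F)) :
    (diskEquiv p : Fin (2 * (k + 1)) → F) = join p.1 (p.1 ⬝ᵥ p.1) p.2 (p.1 ⬝ᵥ p.2) := rfl

variable [Fintype F]

theorem card_flatDisk : Fintype.card (flatDisk F (k + 1)) = Fintype.card F ^ (2 * k) := by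
  rw [← Fintype.card_congr diskEquiv]
  simp [two_mul, pow_add]

end Coordinates

/-! ### Fourier decay of the surface measure and its paraboloid part. -/

section Kernels

variable {F : Type u} [Field F] [Fintype F] {k : ℕ}

theorem surfaceMeasureInv_eq_charKernel (m : Fin (2 * (k + 1)) → F) :
    surfaceMeasureInv F (k + 1) m = charKernel ((Fintype.card F : ℝ) ^ (2 * k))⁻¹
      (fun x : flatDisk F (k + 1) => (x : Fin (2 * (k + 1)) → F)) m := by
  simp only [surfaceMeasureInv, extension, charKernel, card_flatDisk, mul_one]
  push_cast
  rfl

open scoped Classical in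
-- For fixed `α` the phase is linear in `β` with coefficient `b + t α`, so orthogonality evaluates
-- the sum over `β`.
theorem surfaceMeasureInv_join (a b : Fin k → F) (s t : F) :
    surfaceMeasureInv F (k + 1) (join a s b t) = ((Fintype.card F : ℂ) ^ k)⁻¹ *
      ∑ α : Fin k → F, if b + t • α = 0 then canonicalChar F (α ⬝ᵥ a + (α ⬝ᵥ α) * s) else 0 := by
  have h : ∑ x : flatDisk F (k + 1), canonicalChar F ((x : Fin (2 * (k + 1)) → F) ⬝ᵥ join a s b t) =
      (Fintype.card F : ℂ) ^ k * ∑ α : Fin k → F,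
        if b + t • α = 0 then canonicalChar F (α ⬝ᵥ a + (α ⬝ᵥ α) * s) else 0 := by
    rw [← diskEquiv.sum_comp, Fintype.sum_prod_type, Finset.mul_sum]
    refine Finset.sum_congr rfl fun α _ => ?_
    calc _ = canonicalChar F (α ⬝ᵥ a + (α ⬝ᵥ α) * s) *
          ∑ β : Fin k → F, canonicalChar F (β ⬝ᵥ (b + t • α)) := by
          rw [Finset.mul_sum]
          refine Finset.sum_congr rfl fun β _ => ?_
          rw [diskEquiv_coe, join_dotProduct_join, AddChar.map_add_eq_mul]
          congr 2
          simp only [dotProduct_add, dotProduct_smul, smul_eq_mul, dotProduct_comm α β]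
          ring
      _ = _ := by
          rw [sum_canonicalChar_dotProduct, Fintype.card_fin]
          split_ifs <;> ring
  have hq : (Fintype.card F : ℂ) ≠ 0 := by simp
  simp only [surfaceMeasureInv, extension, mul_one, h, card_flatDisk]
  push_cast
  rw [two_mul, pow_add, ← mul_assoc]
  congr 1
  field_simp

theorem norm_surfaceMeasureInv_of_ne_zero (a b : Fin k → F) (s : F) {t : F} (ht : t ≠ 0) :
    ‖surfaceMeasureInv F (k + 1) (join a s b t)‖ = ((Fintype.card F : ℝ) ^ k)⁻¹ := by
  classical
  have h : ∀ α : Fin k → F, b + t • α = 0 ↔ α = -(t⁻¹ • b) := by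
    intro α
    constructor
    · intro h
      rw [eq_neg_of_add_eq_zero_left h, smul_neg, neg_neg, smul_smul, inv_mul_cancel₀ ht, one_smul]
    · rintro rfl
      rw [smul_neg, smul_smul, mul_inv_cancel₀ ht, one_smul, add_neg_cancel]
  rw [surfaceMeasureInv_join]
  simp only [h, Finset.sum_ite_eq', Finset.mem_univ, if_true, norm_mul, norm_canonicalChar]
  simp

theorem surfaceMeasureInv_of_ne_zero (a : Fin k → F) {b : Fin k → F} (hb : b ≠ 0) (s : F) :
    surfaceMeasureInv F (k + 1) (join a s b 0) = 0 := by
  classical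
  simp [surfaceMeasureInv_join, hb]

theorem surfaceMeasureInv_join_zero (a : Fin k → F) (s : F) :
    surfaceMeasureInv F (k + 1) (join a s 0 0) = ((Fintype.card F : ℂ) ^ k)⁻¹ *
      ∑ α : Fin k → F, canonicalChar F (α ⬝ᵥ a + (α ⬝ᵥ α) * s) := by
  classical
  simp [surfaceMeasureInv_join]

theorem surfaceMeasureInv_zero : surfaceMeasureInv F (k + 1) 0 = 1 := by
  have h : (0 : Fin (2 * (k + 1)) → F) = join 0 0 0 0 := (join_eq_zero.2 ⟨rfl, rfl, rfl, rfl⟩).symm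
  rw [h, surfaceMeasureInv_join_zero]
  simp

theorem norm_surfaceMeasureInv_quadratic (h2 : (2 : F) ≠ 0) (a : Fin k → F) {s : F} (hs : s ≠ 0) :
    ‖surfaceMeasureInv F (k + 1) (join a s 0 0)‖ = (Fintype.card F : ℝ) ^ (-(k : ℝ) / 2) := by
  have hq : (0 : ℝ) < Fintype.card F := by simp [Fintype.card_pos]
  rw [surfaceMeasureInv_join_zero, norm_mul, norm_quadratic_sum h2 hs, Fintype.card_fin, norm_inv,
    norm_pow, Complex.norm_natCast, ← Real.rpow_natCast, ← Real.rpow_neg hq.le,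
    ← Real.rpow_add hq]
  congr 1
  ring

theorem surfaceMeasureInv_linear {a : Fin k → F} (ha : a ≠ 0) :
    surfaceMeasureInv F (k + 1) (join a 0 0 0) = 0 := by
  classical
  rw [surfaceMeasureInv_join_zero]
  simp [sum_canonicalChar_dotProduct, ha]

theorem one_le_card : (1 : ℝ) ≤ Fintype.card F := by exact_mod_cast Fintype.card_pos

theorem inv_pow_le_rpow : ((Fintype.card F : ℝ) ^ k)⁻¹ ≤ (Fintype.card F : ℝ) ^ (-(k : ℝ) / 2) := by
  rw [← Real.rpow_natCast, ← Real.rpow_neg (by positivity)]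
  refine Real.rpow_le_rpow_of_exponent_le one_le_card ?_
  have : (0 : ℝ) ≤ k := by positivity
  linarith

theorem norm_surfaceMeasureInv_le (h2 : (2 : F) ≠ 0) {m : Fin (2 * (k + 1)) → F} (hm : m ≠ 0) :
    ‖surfaceMeasureInv F (k + 1) m‖ ≤ (Fintype.card F : ℝ) ^ (-(k : ℝ) / 2) := by
  obtain ⟨a, s, b, t, rfl⟩ := exists_eq_join m
  have h0 : (0 : ℝ) ≤ (Fintype.card F : ℝ) ^ (-(k : ℝ) / 2) := by positivity
  by_cases ht : t = 0
  · subst ht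
    by_cases hb : b = 0
    · subst hb
      by_cases hs : s = 0
      · subst hs
        have ha : a ≠ 0 := by rintro rfl; exact hm (join_eq_zero.2 ⟨rfl, rfl, rfl, rfl⟩)
        rwa [surfaceMeasureInv_linear ha, norm_zero]
      · exact (norm_surfaceMeasureInv_quadratic h2 a hs).le
    · rwa [surfaceMeasureInv_of_ne_zero a hb, norm_zero]
  · rw [norm_surfaceMeasureInv_of_ne_zero a b s ht]
    exact inv_pow_le_rpow

/-- The part of `(dσ)^∨` on the subspace where the last `k + 1` coordinates vanish. -/
noncomputable def paraboloidKernel (F : Type u) [Field F] [Fintype F] (k : ℕ) :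
    (Fin (2 * (k + 1)) → F) → ℂ :=
  charKernel ((Fintype.card F : ℝ) ^ (2 * k + 1))⁻¹
    fun p : (Fin k → F) × ((Fin k → F) × F) => join p.1 (p.1 ⬝ᵥ p.1) p.2.1 p.2.2

open scoped Classical in
-- The free variables `β` and `τ` give delta functions at `b = 0` and `t = 0`. Their mass `q^(k+1)`
-- turns the weight `q^(-(2k+1))` into the `q^(-k)` of `surfaceMeasureInv_join_zero`.
theorem paraboloidKernel_join (a b : Fin k → F) (s t : F) :
    paraboloidKernel F k (join a s b t) =
      if b = 0 ∧ t = 0 then surfaceMeasureInv F (k + 1) (join a s 0 0) else 0 := by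
  have h : ∑ p : (Fin k → F) × ((Fin k → F) × F),
      canonicalChar F (join p.1 (p.1 ⬝ᵥ p.1) p.2.1 p.2.2 ⬝ᵥ join a s b t) =
      (∑ α : Fin k → F, canonicalChar F (α ⬝ᵥ a + (α ⬝ᵥ α) * s)) *
        ((∑ β : Fin k → F, canonicalChar F (β ⬝ᵥ b)) * ∑ τ : F, canonicalChar F (τ * t)) := by
    rw [Finset.sum_mul_sum, ← Fintype.sum_prod_type', Finset.sum_mul_sum, ← Fintype.sum_prod_type']
    refine Finset.sum_congr rfl fun p _ => ?_
    rw [join_dotProduct_join, AddChar.map_add_eq_mul, AddChar.map_add_eq_mul _ (p.2.1 ⬝ᵥ b)]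
  have hq : (Fintype.card F : ℂ) ≠ 0 := by simp
  rw [paraboloidKernel, charKernel, h, sum_canonicalChar_dotProduct,
    AddChar.sum_mulShift _ canonicalChar_isPrimitive, surfaceMeasureInv_join_zero, Fintype.card_fin]
  by_cases hb : b = 0 <;> by_cases ht : t = 0 <;> simp [hb, ht]
  rw [mul_comm (∑ α : Fin k → F, _), ← mul_assoc, ← mul_assoc]
  congr 1
  field_simp
  ring

theorem norm_surfaceMeasureInv_sub_paraboloidKernel_le (m : Fin (2 * (k + 1)) → F) :
    ‖surfaceMeasureInv F (k + 1) m - paraboloidKernel F k m‖ ≤ ((Fintype.card F : ℝ) ^ k)⁻¹ := by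
  classical
  obtain ⟨a, s, b, t, rfl⟩ := exists_eq_join m
  have h0 : (0 : ℝ) ≤ ((Fintype.card F : ℝ) ^ k)⁻¹ := by positivity
  rw [paraboloidKernel_join]
  by_cases ht : t = 0
  · subst ht
    by_cases hb : b = 0
    · simp [hb]
    · simp [hb, surfaceMeasureInv_of_ne_zero a hb]
  · simp [ht, norm_surfaceMeasureInv_of_ne_zero a b s ht]

open scoped Classical in
theorem norm_paraboloidKernel_sub_le (h2 : (2 : F) ≠ 0) (m : Fin (2 * (k + 1)) → F) :
    ‖paraboloidKernel F k m - if m = 0 then 1 else 0‖ ≤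
      (Fintype.card F : ℝ) ^ (-(k : ℝ) / 2) := by
  have h0 : (0 : ℝ) ≤ (Fintype.card F : ℝ) ^ (-(k : ℝ) / 2) := by positivity
  obtain ⟨a, s, b, t, rfl⟩ := exists_eq_join m
  rw [paraboloidKernel_join]
  by_cases hbt : b = 0 ∧ t = 0
  · obtain ⟨rfl, rfl⟩ := hbt
    by_cases hm : join a s 0 0 = 0
    · simpa [hm, surfaceMeasureInv_zero] using h0
    · simpa [hm] using norm_surfaceMeasureInv_le h2 hm
  · have hm : join a s b t ≠ 0 := fun h => hbt (join_eq_zero.1 h).2.2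
    simpa [hm, hbt] using h0

end Kernels

end FlatDisk

namespace FlatDisk

open ComplexConjugate

/-! ### The measure-theoretic norms as finite sums. -/

section Norms

variable {F : Type u} [Fintype F] {d k : ℕ}

theorem eLpNorm_countingMeasure {p : ℝ} (hp : 0 < p) (g : (Fin (2 * d) → F) → ℂ) :
    eLpNorm g (ENNReal.ofReal p) (countingMeasure F d) = ENNReal.ofReal (sumNorm p g) := by
  let _ : MeasurableSpace (Fin (2 * d) → F) := ⊤
  exact eLpNorm_count_eq hp g

variable [Field F]

theorem eLpNorm_surfaceMeasure (f : flatDisk F (k + 1) → ℂ) :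
    eLpNorm f 2 (surfaceMeasure F (k + 1)) =
      ENNReal.ofReal (√((Fintype.card F : ℝ) ^ (2 * k))⁻¹ * sumNorm 2 f) := by
  let _ : MeasurableSpace (flatDisk F (k + 1)) := ⊤
  have h := eLpNorm_count_eq two_pos f
  rw [ENNReal.ofReal_ofNat] at h
  have hc : ((Fintype.card (flatDisk F (k + 1)) : ℝ≥0∞))⁻¹ =
      ENNReal.ofReal (((Fintype.card F : ℝ) ^ (2 * k))⁻¹) := by
    have hq : (0 : ℝ) < Fintype.card F := by simp [Fintype.card_pos]
    rw [ENNReal.ofReal_inv_of_pos (by positivity), card_flatDisk, ← Nat.cast_pow,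
      ENNReal.ofReal_natCast]
  rw [surfaceMeasure, eLpNorm_smul_measure_of_ne_top (by simp), h, hc,
    ENNReal.ofReal_mul (Real.sqrt_nonneg _), Real.sqrt_eq_rpow,
    ← ENNReal.ofReal_rpow_of_nonneg (by positivity) (by norm_num), smul_eq_mul]
  norm_num

/-- Displays the extension operator as the adjoint, in the form required by `adjoint_bound_iff`, of
the restriction kernel. -/
theorem extension_eq (f : flatDisk F (k + 1) → ℂ) :
    extension f = fun m => ((((Fintype.card F : ℝ) ^ (2 * k))⁻¹ : ℝ) : ℂ) *
      ∑ x : flatDisk F (k + 1),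
        conj (canonicalChar F (-((x : Fin (2 * (k + 1)) → F) ⬝ᵥ m))) * f x := by
  funext m
  simp only [extension, card_flatDisk, ← AddChar.map_neg_eq_conj, neg_neg]
  push_cast
  rfl

variable (F) in
theorem extensionConst_eq_restrictionConst {r s : ℝ} (h : r.HolderConjugate s) :
    extensionConst F (k + 1) 2 (ENNReal.ofReal r) =
      restrictionConst F (k + 1) (ENNReal.ofReal s) 2 := by
  unfold extensionConst restrictionConst
  congr 1
  ext C
  simp only [Set.mem_ofPred_eq, eLpNorm_countingMeasure h.pos, eLpNorm_countingMeasure h.symm.pos,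
    eLpNorm_surfaceMeasure, extension_eq]
  exact adjoint_bound_iff
    (fun (x : flatDisk F (k + 1)) m => canonicalChar F (-((x : Fin (2 * (k + 1)) → F) ⬝ᵥ m)))
    (by positivity) h C

end Norms

/-! ### The restriction estimate at the critical exponent. -/

section Restriction

variable {F : Type u} [Field F] [Fintype F] {k : ℕ}

/-- Reduces restriction to a convolution form, whose kernel can be split. -/
theorem restriction_sq_eq_form (g : (Fin (2 * (k + 1)) → F) → ℂ) :
    (((√((Fintype.card F : ℝ) ^ (2 * k))⁻¹ *
      sumNorm 2 fun x : flatDisk F (k + 1) => fourier g x) ^ 2 : ℝ) : ℂ) =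
      ∑ m, ∑ m', surfaceMeasureInv F (k + 1) (m' - m) * g m * conj (g m') := by
  simp only [surfaceMeasureInv_eq_charKernel]
  rw [form_charKernel _ _ _ (fun m => conj (g m)), mul_pow, Real.sq_sqrt (by positivity),
    sumNorm_two, Real.sq_sqrt (by positivity), Complex.ofReal_mul]
  congr 1
  push_cast
  refine Finset.sum_congr rfl fun x _ => ?_
  rw [← Complex.mul_conj']
  congr 1
  simp only [fourier, map_sum, map_mul, ← AddChar.map_neg_eq_conj, neg_neg]

theorem norm_form_surfaceMeasureInv_le (f g : (Fin (2 * (k + 1)) → F) → ℂ) :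
    ‖∑ m, ∑ m', surfaceMeasureInv F (k + 1) (m' - m) * f m * g m'‖ ≤
      (Fintype.card F : ℝ) ^ 2 * sumNorm 2 f * sumNorm 2 g := by
  simp only [surfaceMeasureInv_eq_charKernel]
  refine (norm_form_charKernel_le (by positivity) Subtype.coe_injective f g).trans (le_of_eq ?_)
  have hq : (0 : ℝ) < Fintype.card F := by simp [Fintype.card_pos]
  congr 2
  rw [Fintype.card_fin, inv_mul_eq_iff_eq_mul₀ (by positivity)]
  ring

theorem norm_form_paraboloidKernel_le (f g : (Fin (2 * (k + 1)) → F) → ℂ) :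
    ‖∑ m, ∑ m', paraboloidKernel F k (m' - m) * f m * g m'‖ ≤
      (Fintype.card F : ℝ) * sumNorm 2 f * sumNorm 2 g := by
  have hinj : Function.Injective
      fun p : (Fin k → F) × ((Fin k → F) × F) => join p.1 (p.1 ⬝ᵥ p.1) p.2.1 p.2.2 := by
    rintro ⟨α, β, τ⟩ ⟨α', β', τ'⟩ h
    simp only [join_inj] at h
    simp [h.1, h.2.2.1, h.2.2.2]
  refine (norm_form_charKernel_le (by positivity) hinj f g).trans (le_of_eq ?_)
  have hq : (0 : ℝ) < Fintype.card F := by simp [Fintype.card_pos]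
  congr 2
  rw [Fintype.card_fin, inv_mul_eq_iff_eq_mul₀ (by positivity)]
  ring

theorem form_diagonal {V : Type*} [Fintype V] [DecidableEq V] [AddCommGroup V] (f g : V → ℂ) :
    ∑ m, ∑ m', (if m' - m = 0 then (1 : ℂ) else 0) * f m * g m' = ∑ m, f m * g m := by
  simp [sub_eq_zero]

theorem form_sub {V : Type*} [Fintype V] [AddCommGroup V] (K L : V → ℂ) (f g : V → ℂ) :
    ∑ m, ∑ m', (K (m' - m) - L (m' - m)) * f m * g m' =
      ∑ m, ∑ m', K (m' - m) * f m * g m' - ∑ m, ∑ m', L (m' - m) * f m * g m' := by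
  simp only [← Finset.sum_sub_distrib, sub_mul]

theorem rpow_balance {q a b θ : ℝ} (hq : 0 < q) (hθ : a * (1 - θ) + b * θ = 0)
    (h0 : 0 ≤ θ) : (2 * q ^ a) ^ (1 - θ) * (q ^ b) ^ θ ≤ 2 := by
  rw [Real.mul_rpow two_pos.le (Real.rpow_nonneg hq.le _), ← Real.rpow_mul hq.le,
    ← Real.rpow_mul hq.le, mul_assoc, ← Real.rpow_add hq, hθ, Real.rpow_zero, mul_one]
  calc (2 : ℝ) ^ (1 - θ) ≤ 2 ^ (1 : ℝ) :=
        Real.rpow_le_rpow_of_exponent_le one_le_two (by linarith)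
    _ = 2 := Real.rpow_one 2

/-- The restriction estimate at the critical exponent. -/
theorem sumNorm_fourier_le (h2 : (2 : F) ≠ 0) (g : (Fin (2 * (k + 1)) → F) → ℂ) :
    √((Fintype.card F : ℝ) ^ (2 * k))⁻¹ * sumNorm 2 (fun x : flatDisk F (k + 1) => fourier g x) ≤
      3 * sumNorm ((2 * k + 4) / (k + 4)) g := by
  classical
  set q : ℝ := (Fintype.card F : ℝ) with hq
  have hq0 : 0 < q := by simp [hq, Fintype.card_pos]
  have hq1 : 1 ≤ q := one_le_card (F := F)
  set p : ℝ := (2 * k + 4) / (k + 4) with hp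
  -- Forced by `2 (1 - θ) = k θ`; the second piece has both exponents halved and so needs the same
  -- `θ`. Then `p = 2 / (1 + θ)`.
  set θ : ℝ := 2 / (k + 2) with hθ
  have hk : (0 : ℝ) ≤ k := k.cast_nonneg
  have hp0 : 0 < p := by positivity
  have hp2 : p ≤ 2 := by rw [hp, div_le_iff₀ (by positivity)]; linarith
  have hθ0 : 0 ≤ θ := by positivity
  have hθ1 : θ ≤ 1 := by rw [hθ, div_le_one (by positivity)]; linarith
  have hpθ : p / 2 * (1 + θ) = 1 := by rw [hp, hθ]; field_simp; ring
  have dec : ∀ f g : (Fin (2 * (k + 1)) → F) → ℂ,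
      ‖∑ m, ∑ m', (surfaceMeasureInv F (k + 1) (m' - m) - paraboloidKernel F k (m' - m)) *
        f m * g m'‖ ≤ 2 * sumNorm p f * sumNorm p g := by
    intro f g
    have hA : (q ^ k)⁻¹ = q ^ (-(k : ℝ)) := by rw [Real.rpow_neg hq0.le, Real.rpow_natCast]
    refine (norm_form_le_interp (A := q ^ (-(k : ℝ))) (B := 2 * q ^ (2 : ℝ)) (θ := θ) (p := p)
      (fun m m' => surfaceMeasureInv F (k + 1) (m' - m) - paraboloidKernel F k (m' - m))
      (by positivity) (by positivity) hθ0 hθ1 hp0 hpθ (fun m m' => ?_) (fun f g => ?_) f g).trans ?_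
    · rw [← hA]
      exact norm_surfaceMeasureInv_sub_paraboloidKernel_le _
    · rw [form_sub]
      refine (norm_sub_le _ _).trans ?_
      have e1 := norm_form_surfaceMeasureInv_le f g
      have e2 := norm_form_paraboloidKernel_le f g
      have e3 := mul_nonneg (sumNorm_nonneg 2 f) (sumNorm_nonneg 2 g)
      have e4 : q ≤ q ^ 2 := by nlinarith
      rw [Real.rpow_two]
      nlinarith
    · have hb : (2 : ℝ) * (1 - θ) + -(k : ℝ) * θ = 0 := by rw [hθ]; field_simp; ring
      have := rpow_balance hq0 hb hθ0
      have := sumNorm_nonneg p f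
      have := sumNorm_nonneg p g
      gcongr
  have par : ∀ f g : (Fin (2 * (k + 1)) → F) → ℂ,
      ‖∑ m, ∑ m', (paraboloidKernel F k (m' - m) - if m' - m = 0 then 1 else 0) *
        f m * g m'‖ ≤ 2 * sumNorm p f * sumNorm p g := by
    intro f g
    refine (norm_form_le_interp (A := q ^ (-(k : ℝ) / 2)) (B := 2 * q ^ (1 : ℝ)) (θ := θ) (p := p)
      (fun m m' => paraboloidKernel F k (m' - m) - if m' - m = 0 then 1 else 0)
      (by positivity) (by positivity) hθ0 hθ1 hp0 hpθ (fun m m' => ?_) (fun f g => ?_) f g).trans ?_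
    · exact norm_paraboloidKernel_sub_le h2 _
    · rw [form_sub _ (fun m => if m = 0 then 1 else 0), form_diagonal]
      refine (norm_sub_le _ _).trans ?_
      have e1 := norm_form_paraboloidKernel_le f g
      have e2 := norm_sum_mul_le Real.HolderConjugate.two_two f g
      have e3 := mul_nonneg (sumNorm_nonneg 2 f) (sumNorm_nonneg 2 g)
      rw [Real.rpow_one]
      nlinarith
    · have hb : (1 : ℝ) * (1 - θ) + -(k : ℝ) / 2 * θ = 0 := by rw [hθ]; field_simp; ring
      have := rpow_balance hq0 hb hθ0
      have := sumNorm_nonneg p f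
      have := sumNorm_nonneg p g
      gcongr
  have key := restriction_sq_eq_form g
  set Y := √(q ^ (2 * k))⁻¹ * sumNorm 2 (fun x : flatDisk F (k + 1) => fourier g x) with hY
  have split : ∑ m, ∑ m', surfaceMeasureInv F (k + 1) (m' - m) * g m * conj (g m') =
      (∑ m, ∑ m', (surfaceMeasureInv F (k + 1) (m' - m) - paraboloidKernel F k (m' - m)) *
        g m * conj (g m')) +
      (∑ m, ∑ m', (paraboloidKernel F k (m' - m) - if m' - m = 0 then 1 else 0) *
        g m * conj (g m')) + ∑ m, g m * conj (g m) := by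
    rw [form_sub _ _ _ (fun m => conj (g m)),
      form_sub _ (fun m => if m = 0 then 1 else 0) _ (fun m => conj (g m)),
      form_diagonal _ (fun m => conj (g m))]
    ring
  have hZ := sumNorm_nonneg p g
  have e1 := dec g (fun m => conj (g m))
  have e2 := par g (fun m => conj (g m))
  have e3 := norm_sum_mul_le Real.HolderConjugate.two_two g (fun m => conj (g m))
  rw [sumNorm_conj] at e1 e2 e3
  have e4 := sumNorm_two_le hp0 hp2 g
  have e5 := mul_le_mul e4 e4 (sumNorm_nonneg 2 g) hZ
  -- `5 = 2 + 2 + 1`, one summand for each piece of the kernel; `5 ≤ 3²` then gives the constant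
  -- `3`.
  have hY2 : Y ^ 2 ≤ 5 * (sumNorm p g * sumNorm p g) := by
    have : Y ^ 2 = ‖((Y ^ 2 : ℝ) : ℂ)‖ := by
      rw [Complex.norm_real, Real.norm_of_nonneg (sq_nonneg _)]
    rw [this, key, split]
    refine (norm_add₃_le).trans ?_
    linarith
  refine abs_le_of_sq_le_sq' ?_ (by positivity) |>.2
  nlinarith [mul_nonneg hZ hZ]

theorem restrictionConst_le (h2 : (2 : F) ≠ 0) :
    restrictionConst F (k + 1) (ENNReal.ofReal ((2 * k + 4) / (k + 4))) 2 ≤ 3 := by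
  refine sInf_le fun g => ?_
  rw [eLpNorm_surfaceMeasure, eLpNorm_countingMeasure (by positivity)]
  refine (ENNReal.ofReal_le_ofReal (sumNorm_fourier_le h2 g)).trans ?_
  rw [ENNReal.ofReal_mul (by norm_num)]
  simp

end Restriction

/-! ### Lower bounds from a subspace contained in the disk. -/

section Sharpness

variable {F : Type u} [Field F] [Fintype F] {k : ℕ}

theorem sumNorm_ite {X : Type*} [Fintype X] {P : X → Prop} [DecidablePred P] {p : ℝ} (hp : 0 < p)
    (z : ℂ) : sumNorm p (fun x => if P x then z else 0) =
      (Fintype.card {x // P x} : ℝ) ^ (1 / p) * ‖z‖ := by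
  have h : ∑ x, ‖if P x then z else 0‖ ^ p = Fintype.card {x // P x} * ‖z‖ ^ p := by
    simp only [apply_ite (fun z : ℂ => ‖z‖ ^ p), norm_zero, Real.zero_rpow hp.ne',
      ← Finset.sum_filter, Finset.sum_const, Fintype.card_subtype, nsmul_eq_mul]
  rw [sumNorm, h, Real.mul_rpow (by positivity) (by positivity), ← Real.rpow_mul (norm_nonneg z),
    mul_one_div_cancel hp.ne', Real.rpow_one]

open scoped Classical in
theorem card_third_eq_zero :
    Fintype.card {m : Fin (2 * (k + 1)) → F // (joinEquiv.symm m).2.1 = 0} =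
      Fintype.card F ^ (k + 2) := by
  let e : {m : Fin (2 * (k + 1)) → F // (joinEquiv.symm m).2.1 = 0} ≃ ((Fin k → F) × F) × F :=
    { toFun m := ((joinEquiv.symm m.1).1, (joinEquiv.symm m.1).2.2)
      invFun p := ⟨joinEquiv (p.1, (0, p.2)), by simp⟩
      left_inv m := by
        obtain ⟨m, hm⟩ := m
        apply Subtype.ext
        simp only
        rw [← hm]
        exact joinEquiv.apply_symm_apply m
      right_inv p := by simp }
  rw [Fintype.card_congr e]
  simp [pow_add, pow_two, mul_assoc]

open scoped Classical in
theorem card_disk_fst_eq_zero :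
    Fintype.card {x : flatDisk F (k + 1) // (diskEquiv.symm x).1 = 0} = Fintype.card F ^ k := by
  let e : {x : flatDisk F (k + 1) // (diskEquiv.symm x).1 = 0} ≃ (Fin k → F) :=
    { toFun x := (diskEquiv.symm x.1).2
      invFun β := ⟨diskEquiv (0, β), by simp⟩
      left_inv x := by
        obtain ⟨x, hx⟩ := x
        apply Subtype.ext
        simp only
        rw [← hx]
        exact diskEquiv.apply_symm_apply x
      right_inv p := by simp }
  rw [Fintype.card_congr e]
  simp

open scoped Classical in
-- The slice `α = 0` is the subspace of points `(0, 0, β, 0)`, so its transform is concentrated on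
-- the annihilator `b = 0`.
theorem extension_disk_fst_eq_zero :
    (extension fun x : flatDisk F (k + 1) => if (diskEquiv.symm x).1 = 0 then 1 else 0) =
      fun m => if (joinEquiv.symm m).2.1 = 0 then ((Fintype.card F : ℂ) ^ k)⁻¹ else 0 := by
  funext m
  obtain ⟨⟨⟨a, s⟩, b, t⟩, rfl⟩ := joinEquiv.surjective m
  have hq : (Fintype.card F : ℂ) ≠ 0 := by simp
  rw [extension, ← diskEquiv.sum_comp, Fintype.sum_prod_type, card_flatDisk]
  simp only [Equiv.symm_apply_apply, mul_ite, mul_one, mul_zero]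
  rw [Finset.sum_comm]
  simp only [Finset.sum_ite_eq', Finset.mem_univ, if_true]
  have : ∀ β : Fin k → F, canonicalChar F ((diskEquiv (0, β) : Fin (2 * (k + 1)) → F) ⬝ᵥ
      joinEquiv ((a, s), b, t)) = canonicalChar F (β ⬝ᵥ b) := by
    intro β
    rw [diskEquiv_coe]
    simp only [joinEquiv, Equiv.coe_fn_mk, join_dotProduct_join]
    simp
  simp only [this, sum_canonicalChar_dotProduct, Fintype.card_fin]
  split_ifs
  · push_cast
    field_simp
    ring
  · simp

open scoped Classical in
-- Orthogonality in `a`, `s`, `t` requires `α`, `α ⬝ α` and `α ⬝ β` to vanish; on the disk the first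
-- condition implies the others.
theorem fourier_third_eq_zero (x : flatDisk F (k + 1)) :
    fourier (fun m : Fin (2 * (k + 1)) → F => if (joinEquiv.symm m).2.1 = 0 then 1 else 0) x =
      if (diskEquiv.symm x).1 = 0 then (Fintype.card F : ℂ) ^ (k + 2) else 0 := by
  obtain ⟨⟨α, β⟩, rfl⟩ := diskEquiv.surjective x
  have h : ∀ a s t, canonicalChar F (-((diskEquiv (α, β) : Fin (2 * (k + 1)) → F) ⬝ᵥ
      joinEquiv ((a, s), 0, t))) = canonicalChar F (a ⬝ᵥ (-α)) *
        (canonicalChar F (s * (-(α ⬝ᵥ α))) * canonicalChar F (t * (-(α ⬝ᵥ β)))) := by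
    intro a s t
    rw [diskEquiv_coe, ← AddChar.map_add_eq_mul, ← AddChar.map_add_eq_mul]
    simp only [joinEquiv, Equiv.coe_fn_mk, join_dotProduct_join, dotProduct_neg, dotProduct_zero,
      dotProduct_comm α a]
    congr 1
    ring
  rw [fourier, ← joinEquiv.sum_comp]
  simp only [Equiv.symm_apply_apply, Fintype.sum_prod_type, mul_ite, mul_one, mul_zero]
  have h' : ∀ a s, ∑ b : Fin k → F, ∑ t : F, (if b = 0 then canonicalChar F
      (-((diskEquiv (α, β) : Fin (2 * (k + 1)) → F) ⬝ᵥ joinEquiv ((a, s), b, t))) else 0) =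
      canonicalChar F (a ⬝ᵥ (-α)) * (canonicalChar F (s * (-(α ⬝ᵥ α))) *
        ∑ t, canonicalChar F (t * (-(α ⬝ᵥ β)))) := by
    intro a s
    rw [Finset.sum_comm]
    simp only [Finset.sum_ite_eq', Finset.mem_univ, if_true, h, Finset.mul_sum]
  simp only [h', ← Finset.mul_sum, ← Finset.sum_mul, sum_canonicalChar_dotProduct,
    AddChar.sum_mulShift _ canonicalChar_isPrimitive, Fintype.card_fin, neg_eq_zero]
  by_cases h0 : α = 0
  · simp only [h0, zero_dotProduct, if_true]
    ring
  · simp [h0]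

theorem sqrt_inv_mul_rpow_half {q : ℝ} (hq : 0 < q) (k : ℕ) :
    √(q ^ (2 * k))⁻¹ * ((q ^ k : ℝ)) ^ (1 / 2 : ℝ) = q ^ (-(k : ℝ) / 2) := by
  rw [Real.sqrt_eq_rpow, ← Real.mul_rpow (by positivity) (by positivity)]
  rw [two_mul, pow_add, mul_inv, mul_assoc, inv_mul_cancel₀ (by positivity), mul_one,
    ← Real.rpow_natCast, ← Real.rpow_neg hq.le, ← Real.rpow_mul hq.le]
  congr 1
  ring

theorem ofReal_rpow_le_of_le_mul {q a b : ℝ} (hq : 0 < q) {C : ℝ≥0∞}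
    (h : ENNReal.ofReal (q ^ a) ≤ C * ENNReal.ofReal (q ^ b)) :
    ENNReal.ofReal (q ^ (a - b)) ≤ C := by
  have hb : 0 < q ^ b := Real.rpow_pos_of_pos hq b
  rw [Real.rpow_sub hq, ENNReal.ofReal_div_of_pos hb]
  exact ENNReal.div_le_of_le_mul h

theorem le_extensionConst {r : ℝ} (hr : 0 < r) :
    ENNReal.ofReal ((Fintype.card F : ℝ) ^ ((k + 2) / r - k / 2)) ≤
      extensionConst F (k + 1) 2 (ENNReal.ofReal r) := by
  classical
  have hq : (0 : ℝ) < Fintype.card F := by simp [Fintype.card_pos]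
  refine le_sInf fun C hC => ?_
  have h := hC fun x => if (diskEquiv.symm x).1 = 0 then 1 else 0
  rw [extension_disk_fst_eq_zero, eLpNorm_countingMeasure hr, eLpNorm_surfaceMeasure,
    sumNorm_ite hr, sumNorm_ite two_pos, card_third_eq_zero, card_disk_fst_eq_zero, norm_one,
    mul_one, Nat.cast_pow, Nat.cast_pow, sqrt_inv_mul_rpow_half hq, norm_inv, norm_pow,
    Complex.norm_natCast, ← Real.rpow_natCast_mul hq.le, ← Real.rpow_natCast,
    ← Real.rpow_neg hq.le, ← Real.rpow_add hq] at h
  have e : ((k : ℝ) + 2) / r - k / 2 = ((k + 2 : ℕ) : ℝ) * (1 / r) + -k - -k / 2 := by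
    push_cast
    ring
  rw [e]
  exact ofReal_rpow_le_of_le_mul hq h

/-- At `t = ⊤`, `t.toReal = 0` and division by zero make the exponent `0`, which gives the correct
bound `1`. -/
theorem eLpNorm_third_eq_zero_le [DecidableEq F] {t : ℝ≥0∞} (ht : t ≠ 0) :
    eLpNorm (fun m : Fin (2 * (k + 1)) → F => if (joinEquiv.symm m).2.1 = 0 then (1 : ℂ) else 0) t
      (countingMeasure F (k + 1)) ≤
      ENNReal.ofReal ((Fintype.card F : ℝ) ^ ((k + 2) / t.toReal)) := by
  have hq : (0 : ℝ) < Fintype.card F := by simp [Fintype.card_pos]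
  by_cases htop : t = ⊤
  · subst htop
    let _ : MeasurableSpace (Fin (2 * (k + 1)) → F) := ⊤
    rw [eLpNorm_exponent_top]
    refine (eLpNormEssSup_le_of_ae_bound (C := 1) (Filter.Eventually.of_forall fun m => ?_)).trans ?_
    · split_ifs <;> simp
    · simp
  · have ht' : 0 < t.toReal := ENNReal.toReal_pos ht htop
    nth_rewrite 1 [← ENNReal.ofReal_toReal htop]
    rw [eLpNorm_countingMeasure ht', sumNorm_ite ht', norm_one, mul_one]
    have := card_third_eq_zero (F := F) (k := k)
    rw [Fintype.card_eq_nat_card] at this ⊢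
    rw [this, Nat.cast_pow, ← Real.rpow_natCast_mul hq.le]
    apply le_of_eq
    congr 2
    push_cast
    ring

theorem le_restrictionConst {t : ℝ≥0∞} (ht : t ≠ 0) :
    ENNReal.ofReal ((Fintype.card F : ℝ) ^ ((k + 4) / 2 - (k + 2) / t.toReal)) ≤
      restrictionConst F (k + 1) t 2 := by
  classical
  have hq : (0 : ℝ) < Fintype.card F := by simp [Fintype.card_pos]
  refine le_sInf fun C hC => ?_
  have h := hC fun m => if (joinEquiv.symm m).2.1 = 0 then 1 else 0
  simp only [fourier_third_eq_zero] at h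
  rw [eLpNorm_surfaceMeasure, sumNorm_ite two_pos, card_disk_fst_eq_zero, Nat.cast_pow,
    ← mul_assoc, sqrt_inv_mul_rpow_half hq, norm_pow, Complex.norm_natCast,
    ← Real.rpow_natCast, ← Real.rpow_add hq] at h
  have h' := h.trans (mul_le_mul_right (eLpNorm_third_eq_zero_le ht) C)
  have e : ((k : ℝ) + 4) / 2 - (k + 2) / t.toReal =
      -k / 2 + ((k + 2 : ℕ) : ℝ) - (k + 2) / t.toReal := by
    push_cast
    ring
  rw [e]
  exact ofReal_rpow_le_of_le_mul hq h'

theorem exists_forall_lt_rpow {ε : ℝ} (hε : 0 < ε) (C : ℝ) :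
    ∃ Q : ℕ, ∀ q : ℕ, Q ≤ q → C < (q : ℝ) ^ ε := by
  have h := (tendsto_rpow_atTop hε).comp (tendsto_natCast_atTop_atTop (R := ℝ))
  exact Filter.eventually_atTop.1 (h.eventually_gt_atTop C)

theorem exists_forall_lt_ofReal_rpow {ε : ℝ} (hε : 0 < ε) (C : ℝ≥0) :
    ∃ Q : ℕ, ∀ q : ℕ, Q ≤ q → (C : ℝ≥0∞) < ENNReal.ofReal ((q : ℝ) ^ ε) := by
  obtain ⟨Q, hQ⟩ := exists_forall_lt_rpow hε C
  refine ⟨Q, fun q hq => ?_⟩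
  rw [← ENNReal.ofReal_coe_nnreal]
  exact (ENNReal.ofReal_lt_ofReal_iff_of_nonneg C.2).2 (hQ q hq)

end Sharpness

/-! ### The exponents available from the Stein–Tomas lemma. -/

section SteinTomas

theorem two_ne_zero_of_odd_card {F : Type*} [Field F] [Fintype F] (h : Odd (Fintype.card F)) :
    (2 : F) ≠ 0 := by
  intro h2
  have h1 : addOrderOf (1 : F) = 2 :=
    addOrderOf_eq_prime (by rw [nsmul_eq_mul, Nat.cast_ofNat, h2, zero_mul]) one_ne_zero
  have := addOrderOf_dvd_card (x := (1 : F))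
  rw [h1] at this
  exact (Nat.not_even_iff_odd.2 h) (even_iff_two_dvd.2 this)

theorem isGreatest_norm_surfaceMeasureInv {F : Type u} [Field F] [Fintype F] (k : ℕ)
    (h2 : (2 : F) ≠ 0) :
    IsGreatest {t : ℝ | ∃ m : Fin (2 * (k + 1)) → F,
      m ≠ 0 ∧ t = ‖surfaceMeasureInv F (k + 1) m‖} ((Fintype.card F : ℝ) ^ (-(k : ℝ) / 2)) := by
  constructor
  · exact ⟨join 0 1 0 0, fun h => one_ne_zero (join_eq_zero.1 h).2.1,
      (norm_surfaceMeasureInv_quadratic h2 0 one_ne_zero).symm⟩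
  · rintro _ ⟨m, hm, rfl⟩
    exact norm_surfaceMeasureInv_le h2 hm

theorem exists_field_odd_card (Q : ℕ) :
    ∃ (F : Type u) (_ : Field F) (_ : Fintype F), Odd (Fintype.card F) ∧ Q ≤ Fintype.card F := by
  obtain ⟨p, hp, hprime⟩ := Nat.exists_infinite_primes (Q + 3)
  have : Fact p.Prime := ⟨hprime⟩
  -- `ULift` places the prime field in the universe `u` over which the hypotheses quantify.
  refine ⟨ULift.{u} (ZMod p), inferInstance, inferInstance, ?_⟩
  rw [Fintype.card_ulift, ZMod.card]
  exact ⟨hprime.odd_of_ne_two (by omega), by omega⟩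

theorem exponent_le_of_forall_card {a b c C : ℝ} (hc : 0 < c)
    (h : ∀ (F : Type u) [Field F] [Fintype F], Odd (Fintype.card F) →
      c * (Fintype.card F : ℝ) ^ a ≤ C * (Fintype.card F : ℝ) ^ b) : a ≤ b := by
  by_contra! hab
  obtain ⟨Q, hQ⟩ := exists_forall_lt_rpow (sub_pos.2 hab) (C / c)
  obtain ⟨F, _, _, hodd, hF⟩ := exists_field_odd_card.{u} Q
  have hq : (0 : ℝ) < Fintype.card F := by simp [Fintype.card_pos]
  have h1 := hQ _ hF
  rw [Real.rpow_sub hq, div_lt_div_iff₀ hc (Real.rpow_pos_of_pos hq b)] at h1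
  linarith [h F hodd]

theorem isLeast_steinTomasExponents {k : ℕ} (hk : 1 ≤ k) :
    IsLeast (steinTomasExponents.{u} (k + 1)) (2 + 8 / k) := by
  have hk0 : (0 : ℝ) < k := by exact_mod_cast hk
  constructor
  · refine ⟨2 * k, k, by omega, by omega, by omega, by omega, ⟨1, 1, one_pos, one_pos, ?_⟩,
      ⟨1, one_pos, ?_⟩, ?_⟩
    · intro F _ _ _
      rw [card_flatDisk, Nat.cast_pow, one_mul]
      exact ⟨le_rfl, le_rfl⟩
    · intro F _ _ hodd m hm
      rw [one_mul]
      exact norm_surfaceMeasureInv_le (two_ne_zero_of_odd_card hodd) hm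
    · push_cast
      ring
  · rintro _ ⟨s, l, hs, hs', hl, hl', ⟨c, C, hc, hC, hsize⟩, ⟨D, hD, hdecay⟩, rfl⟩
    -- Letting `q` grow, the lower size bound forces `s ≤ 2k` and the attained decay forces `l ≤ k`.
    -- The exponent decreases in both, so its minimum is at `(2k, k)`.
    have hsle : (s : ℝ) ≤ ((2 * k : ℕ) : ℝ) := by
      refine exponent_le_of_forall_card.{u} (C := 1) hc fun F _ _ hodd => ?_
      have := (hsize F hodd).1
      rw [card_flatDisk, Nat.cast_pow] at this
      rwa [one_mul, Real.rpow_natCast, Real.rpow_natCast]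
    have hlle : -(k : ℝ) / 2 ≤ -(l : ℝ) / 2 := by
      refine exponent_le_of_forall_card.{u} (C := D) one_pos fun F _ _ hodd => ?_
      obtain ⟨m, hm, hmax⟩ :=
        (isGreatest_norm_surfaceMeasureInv (F := F) k (two_ne_zero_of_odd_card hodd)).1
      rw [one_mul, hmax]
      exact hdecay F hodd m hm
    have hl0 : (0 : ℝ) < l := by exact_mod_cast hl
    have hlk : (l : ℝ) ≤ k := by linarith
    push_cast at hsle ⊢
    have h8 : (8 : ℝ) ≤ 4 * (2 * (k + 1) - s) := by linarith
    have : (8 : ℝ) / k ≤ 4 * (2 * (k + 1) - s) / l :=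
      div_le_div₀ (by linarith) h8 hl0 hlk
    linarith

end SteinTomas

end FlatDisk

/-! ### Assembly, with the exponents rewritten in terms of `k = d - 1`. -/

theorem theorem1 (n d : ℕ) (hn : n = 2 * d) (hn4 : 4 ≤ n) :
    -- the extension estimate
    (∃ C : ℝ≥0, ∀ (F : Type u) [Field F] [Fintype F], Odd (Fintype.card F) →
      FlatDisk.extensionConst F d 2 (ENNReal.ofReal ((2 * (n : ℝ) + 4) / ((n : ℝ) - 2))) ≤ C) ∧
    -- the dual restriction estimate
    (∃ C : ℝ≥0, ∀ (F : Type u) [Field F] [Fintype F], Odd (Fintype.card F) →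
      FlatDisk.restrictionConst F d (ENNReal.ofReal ((2 * (n : ℝ) + 4) / ((n : ℝ) + 6))) 2 ≤ C) ∧
    -- the two estimates are equivalent: they have the same optimal constant
    (∀ (F : Type u) [Field F] [Fintype F], Odd (Fintype.card F) →
      FlatDisk.extensionConst F d 2 (ENNReal.ofReal ((2 * (n : ℝ) + 4) / ((n : ℝ) - 2))) =
        FlatDisk.restrictionConst F d
          (ENNReal.ofReal ((2 * (n : ℝ) + 4) / ((n : ℝ) + 6))) 2) ∧
    -- sharpness of the exponent in the extension estimate
    (∀ r : ℝ≥0∞, 1 ≤ r → r < ENNReal.ofReal ((2 * (n : ℝ) + 4) / ((n : ℝ) - 2)) →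
      ∀ C : ℝ≥0, ∃ Q : ℕ, ∀ (F : Type u) [Field F] [Fintype F], Odd (Fintype.card F) →
        Q ≤ Fintype.card F → (C : ℝ≥0∞) < FlatDisk.extensionConst F d 2 r) ∧
    -- sharpness of the exponent in the restriction estimate
    (∀ t : ℝ≥0∞, ENNReal.ofReal ((2 * (n : ℝ) + 4) / ((n : ℝ) + 6)) < t →
      ∀ C : ℝ≥0, ∃ Q : ℕ, ∀ (F : Type u) [Field F] [Fintype F], Odd (Fintype.card F) →
        Q ≤ Fintype.card F → (C : ℝ≥0∞) < FlatDisk.restrictionConst F d t 2) ∧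
    -- the size of the flat disk and the exact Fourier decay of its surface measure
    (∀ (F : Type u) [Field F] [Fintype F], Odd (Fintype.card F) →
      Fintype.card (FlatDisk.flatDisk F d) = Fintype.card F ^ (n - 2) ∧
      IsGreatest {t : ℝ | ∃ m : Fin (2 * d) → F, m ≠ 0 ∧ t = ‖FlatDisk.surfaceMeasureInv F d m‖}
        ((Fintype.card F : ℝ) ^ (-((n : ℝ) - 2) / 4))) ∧
    -- the best exponent that the Stein–Tomas lemma yields is strictly larger
    IsLeast (FlatDisk.steinTomasExponents.{u} d) ((2 * (n : ℝ) + 12) / ((n : ℝ) - 2)) ∧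
    (2 * (n : ℝ) + 4) / ((n : ℝ) - 2) < (2 * (n : ℝ) + 12) / ((n : ℝ) - 2) := by
  obtain ⟨k, rfl⟩ : ∃ k, d = k + 1 := ⟨d - 1, by omega⟩
  have hk : 1 ≤ k := by omega
  have hk0 : (0 : ℝ) < k := by exact_mod_cast hk
  have hnR : (n : ℝ) = 2 * k + 2 := by rw [hn]; push_cast; ring
  have hr : (2 * (n : ℝ) + 4) / ((n : ℝ) - 2) = (2 * k + 4) / k := by
    rw [hnR, show (2 * (k : ℝ) + 2 - 2) = 2 * k by ring]; field_simp; ring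
  have hs : (2 * (n : ℝ) + 4) / ((n : ℝ) + 6) = (2 * k + 4) / (k + 4) := by
    rw [hnR]; field_simp; ring
  have ht : (2 * (n : ℝ) + 12) / ((n : ℝ) - 2) = 2 + 8 / k := by
    rw [hnR, show (2 * (k : ℝ) + 2 - 2) = 2 * k by ring]; field_simp; ring
  have hdecay : -((n : ℝ) - 2) / 4 = -(k : ℝ) / 2 := by rw [hnR]; ring
  have hn2 : n - 2 = 2 * k := by omega
  have hconj : Real.HolderConjugate ((2 * (k : ℝ) + 4) / k) ((2 * k + 4) / (k + 4)) := by
    rw [Real.holderConjugate_iff]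
    constructor
    · rw [lt_div_iff₀ hk0]; linarith
    · field_simp; ring
  rw [hr, hs, ht, hdecay, hn2]
  have hrestr : ∀ (F : Type u) [Field F] [Fintype F], Odd (Fintype.card F) →
      FlatDisk.restrictionConst F (k + 1) (ENNReal.ofReal ((2 * k + 4) / (k + 4))) 2 ≤
        ((3 : ℝ≥0) : ℝ≥0∞) := fun F _ _ hodd =>
    FlatDisk.restrictionConst_le (FlatDisk.two_ne_zero_of_odd_card hodd)
  refine ⟨⟨3, fun F _ _ hodd => ?_⟩, ⟨3, fun F _ _ hodd => hrestr F hodd⟩,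
    fun F _ _ _ => FlatDisk.extensionConst_eq_restrictionConst F hconj, ?_, ?_,
    fun F _ _ hodd => ⟨FlatDisk.card_flatDisk,
      FlatDisk.isGreatest_norm_surfaceMeasureInv k (FlatDisk.two_ne_zero_of_odd_card hodd)⟩,
    FlatDisk.isLeast_steinTomasExponents hk, ?_⟩
  · rw [FlatDisk.extensionConst_eq_restrictionConst F hconj]
    exact hrestr F hodd
  · intro r hr1 hr C
    have htop : r ≠ ⊤ := hr.ne_top
    have hr0 : 0 < r.toReal := ENNReal.toReal_pos (one_pos.trans_le hr1).ne' htop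
    have hlt : r.toReal < (2 * k + 4) / k := (ENNReal.lt_ofReal_iff_toReal_lt htop).1 hr
    -- The power of `q` in `le_extensionConst` is positive exactly below the critical exponent.
    have hε : 0 < ((k : ℝ) + 2) / r.toReal - k / 2 := by
      rw [lt_div_iff₀ hk0] at hlt
      rw [sub_pos, div_lt_div_iff₀ two_pos hr0]
      linarith
    obtain ⟨Q, hQ⟩ := FlatDisk.exists_forall_lt_ofReal_rpow hε C
    refine ⟨Q, fun F _ _ _ hF => (hQ _ hF).trans_le ?_⟩
    nth_rewrite 2 [← ENNReal.ofReal_toReal htop]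
    exact FlatDisk.le_extensionConst hr0
  · intro t ht C
    have ht0 : t ≠ 0 := (zero_le.trans_lt ht).ne'
    have hε : 0 < ((k : ℝ) + 4) / 2 - (k + 2) / t.toReal := by
      by_cases htop : t = ⊤
      · simp only [htop, ENNReal.toReal_top, div_zero, sub_zero]
        positivity
      · have hpos : 0 < t.toReal := ENNReal.toReal_pos ht0 htop
        have hlt : (2 * (k : ℝ) + 4) / (k + 4) < t.toReal :=
          (ENNReal.ofReal_lt_iff_lt_toReal (by positivity) htop).1 ht
        rw [div_lt_iff₀ (by positivity)] at hlt
        rw [sub_pos, div_lt_div_iff₀ hpos two_pos]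
        linarith
    obtain ⟨Q, hQ⟩ := FlatDisk.exists_forall_lt_ofReal_rpow hε C
    exact ⟨Q, fun F _ _ _ hF => (hQ _ hF).trans_le (FlatDisk.le_restrictionConst ht0)⟩
  · have : (2 * (k : ℝ) + 4) / k = 2 + 4 / k := by field_simp
    rw [this]
    gcongr
    norm_num
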